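/- Let $d\in\{2,3\}$, let $\Omega\subset\mathbb R^d$ be a bounded domain with $C^\infty$ boundary $\Gamma$, and let $\Omega_0\subset\Omega$ be open. Let $g_1,g_2,g_1^\delta,g_2^\delta\in L^\infty(\Gamma)$ be real-valued with $\|g_1^\delta-g_1\|_{\infty,\Gamma}\le\delta$ and $\|g_2^\delta-g_2\|_{\infty,\Gamma}\le\delta$ for some $\delta>0$. Let $P=L^2(\Omega_0)$ or $P=H^1(\Omega_0)$ (real-valued), and assume that there is an exact source $p^\dagger\in P$, i.e. that for some real-valued $v\in H^1(\Omega)$, in the weak sense, $-\Delta v+v=p^\dagger\chi_{\Omega_0}$ in $\Omega$, $v=g_1$ and $\partial v/\partial\mathbf n=g_2$ on $\Gamma$. For $p\in P$ let $u(p)=u_{re}(p)+i\,u_{im}(p)\in H^1(\Omega;\mathbb C)$ be the weak solution of $$-\Delta u+u=p\,\chi_{\Omega_0}\ \text{in }\Omega,\qquad \frac{\partial u}{\partial\mathbf n}+iu=g_2^\delta+i g_1^\delta\ \text{on }\Gamma ,$$ and let $w(p)=w_{re}(p)+i\,w_{im}(p)$ be the weak solution of $-\Delta w+w=u_{im}(p)$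 in $\Omega$, $\partial w/\partial\mathbf n+iw=0$ on $\Gamma$. Call $C_0>0$ a *data error constant* of $\Omega$ if $\|u_{im}(p^\dagger)\|_{L^2(\Omega)}\le C_0\delta$ for all $\Omega_0$, $\delta$, $g_1,g_2,g_1^\delta,g_2^\delta$ as above and all exact sources $p^\dagger\in L^2(\Omega_0)$. Let either $t_0=0$ and $\eta(t)=\eta>0$ be constant, or $t_0=1$ and $\eta(t)=r/t$ with $r>0$. Let $p_0,\dot p_0\in P$ and let $p^\delta:[t_0,\infty)\to P$ be a solution of $$\ddot p^\delta(t)+\eta(t)\,\dot p^\delta(t)+\nabla V(p^\delta(t))=0\quad(t>t_0),\qquad p^\delta(t_0)=p_0,\quad \dot p^\delta(t_0)=\dot p_0,$$ where $\nabla V$ is the gradient of $V(p)=\tfrac12\|u_{im}(p)\|^2_{L^2(\Omega)}$ in the Hilbert space $P$, that is, $(\nabla V(p),z)_P=\int_{\Omega_0}w_{im}(p)\,z\,dx$ for all $z\in P$. (For $P=L^2(\Omega_0)$ this is $\nabla V(p)=w_{im}(p)$ on $\Omega_0$.) For $C_0,\tau$ and $T\ge t_0$ put $$\chi(T)=\|u_{im}(p^\delta(T))\|_{L^2(\Omega)}-C_0\tau\delta,\qquad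 \chi_{TE}(T)=\|u_{im}(p^\delta(T))\|^2_{L^2(\Omega)}+\|\dot p^\delta(T)\|_P^2-C_0^2\tau^2\delta^2 .$$ Then $\Omega$ has a data error constant, and for every data error constant $C_0$ of $\Omega$ and every $\tau>1$: (i) if $\|u_{im}(p_0)\|_{L^2(\Omega)}\ge C_0\tau\delta$, then $\chi$ has at least one root in $[t_0,\infty)$; (ii) if $\|u_{im}(p_0)\|^2_{L^2(\Omega)}+\|\dot p_0\|_P^2\ge C_0^2\tau^2\delta^2$, then $\chi_{TE}$ has exactly one root in $[t_0,\infty)$. -/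

import Mathlib

open MeasureTheory Filter Topology Set
open scoped ContDiff ENNReal ComplexConjugate

noncomputable section

namespace InverseSource

/-- The Euclidean space `ℝ^d`. -/
abbrev E (d : ℕ) : Type := EuclideanSpace ℝ (Fin d)

variable {d : ℕ}

/-- The `i`-th partial derivative of a function on `ℝ^d`. -/
def pderiv {F : Type*} [NormedAddCommGroup F] [NormedSpace ℝ F] (i : Fin d) (φ : E d → F)
    (x : E d) : F :=
  fderiv ℝ φ x (EuclideanSpace.single i 1)

/-- A bounded domain with smooth (`C^∞`) boundary: a bounded open connected non-empty set which,
near each of its boundary points, is the sublevel set `{ρ < 0}` of a smooth function `ρ` whose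
differential does not vanish at that point. -/
structure IsSmoothBoundedDomain (Ω : Set (E d)) : Prop where
  isOpen : IsOpen Ω
  isConnected : IsConnected Ω
  isBounded : Bornology.IsBounded Ω
  smooth_boundary : ∀ x ∈ frontier Ω, ∃ ρ : E d → ℝ, ContDiff ℝ ∞ ρ ∧ fderiv ℝ ρ x ≠ 0 ∧
    ∀ᶠ y in 𝓝 x, (y ∈ Ω ↔ ρ y < 0)

/-- The surface measure on the boundary `Γ = ∂Ω`: the `(d-1)`-dimensional Hausdorff measure,
normalised so as to agree with `(d-1)`-dimensional Lebesgue measure on hyperplanes. -/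
def surface (Ω : Set (E d)) : Measure (E d) :=
  (Measure.euclideanHausdorffMeasure (d - 1)).restrict (frontier Ω)

/-- `L²(G)` for a subset `G` of `ℝ^d`, with values in `𝕜 = ℝ` or `ℂ`. -/
abbrev L2 (𝕜 : Type) [RCLike 𝕜] (G : Set (E d)) : Type :=
  Lp 𝕜 2 ((volume : Measure (E d)).restrict G)

/-- `L²(Γ)`, where `Γ` is the boundary of `Ω`. -/
abbrev L2Bd (𝕜 : Type) [RCLike 𝕜] (Ω : Set (E d)) : Type := Lp 𝕜 2 (surface Ω)

/-- The test functions on `G`: `φ ∈ C_c^∞(G)`. -/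
structure IsTest (G : Set (E d)) (φ : E d → ℝ) : Prop where
  smooth : ContDiff ℝ ∞ φ
  compact : HasCompactSupport φ
  support : tsupport φ ⊆ G

lemma memLp_mul_integrable {𝕜 : Type} [RCLike 𝕜] {G : Set (E d)} {φ : E d → ℝ}
    (hc : Continuous φ) (hs : HasCompactSupport φ) (u : L2 𝕜 G) :
    Integrable (fun x => (φ x : 𝕜) * u x) ((volume : Measure (E d)).restrict G) := by
  have h1 : MemLp (fun x => (φ x : 𝕜)) 2 ((volume : Measure (E d)).restrict G) :=
    (hc.memLp_of_hasCompactSupport (μ := (volume : Measure (E d)).restrict G) (p := 2) hs).ofReal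
  exact h1.integrable_mul (Lp.memLp u)

lemma IsTest.pderiv_continuous {G : Set (E d)} {φ : E d → ℝ} (h : IsTest G φ) (i : Fin d) :
    Continuous (pderiv i φ) :=
  (h.smooth.continuous_fderiv (by simp)).clm_apply continuous_const

lemma IsTest.pderiv_compact {G : Set (E d)} {φ : E d → ℝ} (h : IsTest G φ) (i : Fin d) :
    HasCompactSupport (pderiv i φ) :=
  h.compact.fderiv_apply ℝ _

/-- The Sobolev space `H¹(G)` with values in `𝕜 = ℝ` or `ℂ`, as a space of families
`U = (u, ∂₁u, …, ∂_d u)` in `L²(G)`: the component `U none` is the function `u` itself and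
`U (some i)` is its `i`-th weak derivative.  The norm and inner product inherited from the
`ℓ²`-product are those of `H¹(G)`, i.e. `‖u‖² = ‖u‖²_{L²} + ∑ᵢ ‖∂ᵢu‖²_{L²}`. -/
def H1 (𝕜 : Type) [RCLike 𝕜] (G : Set (E d)) :
    Submodule 𝕜 (PiLp 2 (fun _ : Option (Fin d) => L2 𝕜 G)) where
  carrier := {U | ∀ φ : E d → ℝ, IsTest G φ → ∀ i : Fin d,
    ∫ x in G, ((pderiv i φ x : ℝ) : 𝕜) * (U none : E d → 𝕜) x =
      -∫ x in G, ((φ x : ℝ) : 𝕜) * (U (some i) : E d → 𝕜) x}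
  zero_mem' := by
    intro φ hφ i
    have h := Lp.coeFn_zero 𝕜 2 ((volume : Measure (E d)).restrict G)
    have h1 : ∫ x in G, ((pderiv i φ x : ℝ) : 𝕜) * ((0 : L2 𝕜 G) : E d → 𝕜) x = 0 :=
      integral_eq_zero_of_ae (by filter_upwards [h] with x hx; rw [hx]; simp)
    have h2 : ∫ x in G, (φ x : 𝕜) * ((0 : L2 𝕜 G) : E d → 𝕜) x = 0 :=
      integral_eq_zero_of_ae (by filter_upwards [h] with x hx; rw [hx]; simp)
    simp only [PiLp.zero_apply]
    rw [h1, h2, neg_zero]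
  add_mem' := by
    intro U V hU hV φ hφ i
    have key : ∀ (ψ : E d → ℝ), Continuous ψ → HasCompactSupport ψ → ∀ a b : L2 𝕜 G,
        ∫ x in G, (ψ x : 𝕜) * ((a + b : L2 𝕜 G) : E d → 𝕜) x =
          (∫ x in G, (ψ x : 𝕜) * a x) + ∫ x in G, (ψ x : 𝕜) * b x := by
      intro ψ hc hs a b
      rw [← integral_add (memLp_mul_integrable hc hs a) (memLp_mul_integrable hc hs b)]
      refine integral_congr_ae ?_
      filter_upwards [Lp.coeFn_add a b] with x hx
      rw [hx, Pi.add_apply, mul_add]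
    simp only [PiLp.add_apply]
    rw [key _ (hφ.pderiv_continuous i) (hφ.pderiv_compact i),
      key _ hφ.smooth.continuous hφ.compact, hU φ hφ i, hV φ hφ i]
    ring
  smul_mem' := by
    intro c U hU φ hφ i
    have key : ∀ (ψ : E d → ℝ) (a : L2 𝕜 G),
        ∫ x in G, (ψ x : 𝕜) * ((c • a : L2 𝕜 G) : E d → 𝕜) x =
          c * ∫ x in G, (ψ x : 𝕜) * a x := by
      intro ψ a
      rw [← integral_const_mul]
      refine integral_congr_ae ?_
      filter_upwards [Lp.coeFn_smul c a] with x hx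
      rw [hx, Pi.smul_apply, smul_eq_mul]
      ring
    simp only [PiLp.smul_apply]
    rw [key, key, hU φ hφ i]
    ring

/-- The function `u ∈ L²(G)` underlying an element of `H¹(G)`. -/
def H1.fn {𝕜 : Type} [RCLike 𝕜] {G : Set (E d)} (u : H1 𝕜 G) : L2 𝕜 G := u.1 none

/-- The `i`-th weak derivative `∂ᵢu ∈ L²(G)` of an element of `H¹(G)`. -/
def H1.wd {𝕜 : Type} [RCLike 𝕜] {G : Set (E d)} (u : H1 𝕜 G) (i : Fin d) : L2 𝕜 G :=
  u.1 (some i)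

/-- The inclusion `H¹(G) → L²(G)` (real-valued functions). -/
def H1.incl (G : Set (E d)) : H1 ℝ G →L[ℝ] L2 ℝ G :=
  (PiLp.proj 2 (fun _ : Option (Fin d) => L2 ℝ G) none).comp (H1 ℝ G).subtypeL

/-- `γ ∈ L²(Γ)` is the trace of `u ∈ H¹(Ω)` on the boundary: there are functions, smooth up to the
boundary, which converge to `u` in `H¹(Ω)` and whose restrictions to `Γ` converge to `γ` in
`L²(Γ)`.  On a smooth bounded domain this relation is the graph of the usual trace operator
`H¹(Ω) → L²(Γ)`, which is defined on all of `H¹(Ω)`. -/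
def HasTrace {𝕜 : Type} [RCLike 𝕜] {Ω : Set (E d)} (u : H1 𝕜 Ω) (γ : L2Bd 𝕜 Ω) : Prop :=
  ∃ φ : ℕ → E d → 𝕜, (∀ n, ContDiff ℝ ∞ (φ n)) ∧
    Tendsto (fun n => eLpNorm (fun x => φ n x - H1.fn u x) 2 (volume.restrict Ω)) atTop (𝓝 0) ∧
    (∀ i, Tendsto (fun n => eLpNorm (fun x => pderiv i (φ n) x - H1.wd u i x) 2
      (volume.restrict Ω)) atTop (𝓝 0)) ∧
    Tendsto (fun n => eLpNorm (fun x => φ n x - γ x) 2 (surface Ω)) atTop (𝓝 0)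

/-- `u ∈ H¹(Ω; ℂ)` is the weak solution of the complex Robin problem
`-Δu + u = F` in `Ω`, `∂u/∂n + i u = h₂ + i h₁` on `Γ`:
`∫_Ω (∇u·∇ψ̄ + u ψ̄) dx + i ∫_Γ u ψ̄ ds = ∫_Ω F ψ̄ dx + ∫_Γ h₂ ψ̄ ds + i ∫_Γ h₁ ψ̄ ds`
for all `ψ ∈ H¹(Ω; ℂ)`. -/
def IsRobinSolution (Ω : Set (E d)) (F h₁ h₂ : E d → ℝ) (u : H1 ℂ Ω) : Prop :=
  ∃ γu : L2Bd ℂ Ω, HasTrace u γu ∧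
    ∀ (ψ : H1 ℂ Ω) (γψ : L2Bd ℂ Ω), HasTrace ψ γψ →
      (∫ x in Ω, ((∑ i, H1.wd u i x * conj (H1.wd ψ i x)) + H1.fn u x * conj (H1.fn ψ x)))
          + Complex.I * ∫ s, γu s * conj (γψ s) ∂(surface Ω) =
        (∫ x in Ω, (F x : ℂ) * conj (H1.fn ψ x))
          + (∫ s, (h₂ s : ℂ) * conj (γψ s) ∂(surface Ω))
          + Complex.I * ∫ s, (h₁ s : ℂ) * conj (γψ s) ∂(surface Ω)

/-- The extension of a function from `Ω₀` by zero, `p χ_{Ω₀}`. -/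
def extend (Ω₀ : Set (E d)) (p : L2 ℝ Ω₀) : E d → ℝ := Ω₀.indicator p

/-- The pair `(p, v)`, with real-valued `v ∈ H¹(Ω)`, solves the inverse source problem
`-Δv + v = p χ_{Ω₀}` in `Ω`, `v = g₁` and `∂v/∂n = g₂` on `Γ`, in the weak sense. -/
def IsExactSolution (Ω Ω₀ : Set (E d)) (g₁ g₂ : E d → ℝ) (p : L2 ℝ Ω₀) (v : H1 ℝ Ω) : Prop :=
  ∃ γv : L2Bd ℝ Ω, HasTrace v γv ∧ γv =ᵐ[surface Ω] g₁ ∧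
    ∀ (ψ : H1 ℝ Ω) (γψ : L2Bd ℝ Ω), HasTrace ψ γψ →
      (∫ x in Ω, ((∑ i, H1.wd v i x * H1.wd ψ i x) + H1.fn v x * H1.fn ψ x)) =
        (∫ x in Ω, extend Ω₀ p x * H1.fn ψ x) + ∫ s, g₂ s * γψ s ∂(surface Ω)

/-- Exact data `g₁, g₂` and noisy data `g₁', g₂'`, all in `L^∞(Γ)`, with
`‖g₁' - g₁‖_{∞,Γ} ≤ δ`, `‖g₂' - g₂‖_{∞,Γ} ≤ δ` and noise level `δ > 0`. -/
structure IsNoisyData (Ω : Set (E d)) (δ : ℝ) (g₁ g₂ g₁' g₂' : E d → ℝ) : Prop where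
  pos : 0 < δ
  mem₁ : MemLp g₁ ∞ (surface Ω)
  mem₂ : MemLp g₂ ∞ (surface Ω)
  mem₁' : MemLp g₁' ∞ (surface Ω)
  mem₂' : MemLp g₂' ∞ (surface Ω)
  noise₁ : ∀ᵐ s ∂(surface Ω), |g₁' s - g₁ s| ≤ δ
  noise₂ : ∀ᵐ s ∂(surface Ω), |g₂' s - g₂ s| ≤ δ

/-- `‖u_im‖_{0,Ω}`, the `L²(Ω)`-norm of the imaginary part of `u`. -/
def imNorm {Ω : Set (E d)} (u : H1 ℂ Ω) : ℝ := √(∫ x in Ω, (H1.fn u x).im ^ 2)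

/-- `C₀ > 0` is a constant, depending on `Ω` only, such that `‖u_im(p†)‖_{0,Ω} ≤ C₀ δ` for every
permissible region `Ω₀`, all exact data with an exact source `p†`, every noise level `δ` and all
noisy data; here `u(p†)` solves the complex Robin problem with source `p†` and the noisy data. -/
structure IsDataErrorConstant (Ω : Set (E d)) (C₀ : ℝ) : Prop where
  pos : 0 < C₀
  bound : ∀ (Ω₀ : Set (E d)), IsOpen Ω₀ → Ω₀ ⊆ Ω →
    ∀ (δ : ℝ) (g₁ g₂ g₁' g₂' : E d → ℝ), IsNoisyData Ω δ g₁ g₂ g₁' g₂' →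
    ∀ (p : L2 ℝ Ω₀) (v : H1 ℝ Ω), IsExactSolution Ω Ω₀ g₁ g₂ p v →
    ∀ u : H1 ℂ Ω, IsRobinSolution Ω (extend Ω₀ p) g₁' g₂' u → imNorm u ≤ C₀ * δ

/-- The two kinds of damping, with the corresponding initial time `t₀`: a constant `η > 0` with
`t₀ = 0`, or `η(t) = r / t` with `r > 0` and `t₀ = 1`. -/
def IsDamping (t₀ : ℝ) (η : ℝ → ℝ) : Prop :=
  (t₀ = 0 ∧ ∃ c > 0, η = fun _ => c) ∨ (t₀ = 1 ∧ ∃ r > 0, η = fun t => r / t)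

/-- `(p, u, w)` is a solution on `[t₀, ∞)` of the second order flow
`p̈(t) + η(t) ṗ(t) + ∇V(p(t)) = 0`, `p(t₀) = p₀`, `ṗ(t₀) = p₁`, in the space of sources `P`, for
`V(p) = ½ ‖u_im(p)‖²_{0,Ω}` with data `g₁', g₂'`.

`J : P → L²(Ω₀)` is the inclusion of the space of sources, `q` is the velocity `ṗ`, `u t` solves
the Robin problem with source `p(t) χ_{Ω₀}` and data `g₁', g₂'`, and `w t` solves the adjoint
problem, with source `u_im(t)` and zero boundary data.  As the derivative of `V` at `p(t)` in the
direction `z` is `∫_{Ω₀} w_im(t) z dx`, the evolution equation in the Hilbert space `P` reads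
`(p̈(t) + η(t) ṗ(t), z)_P + ∫_{Ω₀} w_im(t) z dx = 0` for all `z ∈ P`.  For `P = L²(Ω₀)` this is
`p̈ + η ṗ + w_im = 0` in `Ω₀`. -/
structure IsDynamicSolution {P : Type} [NormedAddCommGroup P] [InnerProductSpace ℝ P]
    (Ω Ω₀ : Set (E d)) (J : P →L[ℝ] L2 ℝ Ω₀) (t₀ : ℝ) (η : ℝ → ℝ) (g₁' g₂' : E d → ℝ)
    (p₀ p₁ : P) (p q : ℝ → P) (u w : ℝ → H1 ℂ Ω) : Prop where
  init_pos : p t₀ = p₀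
  init_vel : q t₀ = p₁
  continuousOn_pos : ContinuousOn p (Ici t₀)
  continuousOn_vel : ContinuousOn q (Ici t₀)
  hasDerivAt_pos : ∀ t, t₀ < t → HasDerivAt p (q t) t
  evolution : ∀ t, t₀ < t → ∃ a : P, HasDerivAt q a t ∧
    ∀ z : P, inner ℝ (a + η t • q t) z + ∫ x in Ω₀, (H1.fn (w t) x).im * J z x = 0
  state : ∀ t, t₀ ≤ t → IsRobinSolution Ω (extend Ω₀ (J (p t))) g₁' g₂' (u t)
  adjoint : ∀ t, t₀ ≤ t → IsRobinSolution Ω (fun x => (H1.fn (u t) x).im) 0 0 (w t)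

/-- Morozov's discrepancy function `χ(T) = ‖u_im(p(T))‖_{0,Ω} - C₀ τ δ`. -/
def morozov {Ω : Set (E d)} (C₀ τ δ : ℝ) (u : ℝ → H1 ℂ Ω) (T : ℝ) : ℝ :=
  imNorm (u T) - C₀ * τ * δ

/-- The total energy discrepancy function
`χ_TE(T) = ‖u_im(p(T))‖²_{0,Ω} + ‖ṗ(T)‖²_P - C₀² τ² δ²`. -/
def totalEnergy {P : Type} [NormedAddCommGroup P] {Ω : Set (E d)} (C₀ τ δ : ℝ)
    (q : ℝ → P) (u : ℝ → H1 ℂ Ω) (T : ℝ) : ℝ :=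
  imNorm (u T) ^ 2 + ‖q T‖ ^ 2 - C₀ ^ 2 * τ ^ 2 * δ ^ 2

end InverseSource

end

open InverseSource

open MeasureTheory Filter Topology Set
open scoped ContDiff ENNReal ComplexConjugate

/-! ### Damped second order flows of a convex quadratic functional. -/

namespace InverseSource

/-! The residual `S = u_im(p)` depends affinely on the source, so `V = ½‖S‖²` is a convex quadratic
and the flow is a damped oscillator. Its energy `E = ‖S‖² + ‖ṗ‖²` has derivative `-2η‖ṗ‖²`. Let `S†`
be the residual of the exact source `p†` and let `c > ‖S†‖²`. If `E ≥ c` held for all times, then by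
convexity of `V` a nonnegative Lyapunov function, built from `⟨ṗ, p - p†⟩`, `‖p - p†‖²` and `E`,
would decrease at a rate of at least `ε` (constant damping) or `ε / t` (damping `r / t`). Neither `ε
t` nor `ε log t` is bounded, so this is impossible (`exists_energy_lt`).

A data error constant gives `‖S†‖ ≤ C₀ δ < C₀ τ δ`, so `E` falls below `C₀² τ² δ²` and the
intermediate value theorem yields the roots. As `E` is nonincreasing, two roots of `χ_TE` would
enclose a plateau of `E`. There the flow is at rest at a critical point of `V`, and by convexity its
residual is at most `‖S†‖`, which is below the level (`energy_ne`).

The boundary value problem enters in three ways: the reciprocity `inner_imPart_comm` identifies the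
force with `∇V`, the Lax–Milgram theorem provides `u(p†)`, and an energy estimate for the difference
of `u(p†)` and the exact `v` gives the data error constant. The weak formulations live on the graph
of the trace relation, a closed subspace of `H¹(Ω) × L²(Γ)`, so no trace theorem is used. The
surface measure has to be finite for bounded boundary data to be square integrable. -/

lemma antitoneOn_Ici_of_hasDerivAt {f f' : ℝ → ℝ} {t₀ : ℝ} (hc : ContinuousOn f (Ici t₀))
    (hf : ∀ t, t₀ < t → HasDerivAt f (f' t) t) (h : ∀ t, t₀ < t → f' t ≤ 0) :
    AntitoneOn f (Ici t₀) := by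
  refine antitoneOn_of_deriv_nonpos (convex_Ici t₀) hc ?_ ?_
  · intro t ht
    rw [interior_Ici] at ht
    exact (hf t ht).differentiableAt.differentiableWithinAt
  · intro t ht
    rw [interior_Ici] at ht
    rw [(hf t ht).deriv]
    exact h t ht

lemma exists_root_Ici {f : ℝ → ℝ} {t₀ T : ℝ} (hc : ContinuousOn f (Ici t₀)) (hT : t₀ ≤ T)
    (h₀ : 0 ≤ f t₀) (h₁ : f T ≤ 0) : ∃ s, t₀ ≤ s ∧ f s = 0 := by
  obtain ⟨s, hs, h⟩ := intermediate_value_Icc' hT (hc.mono Icc_subset_Ici_self) ⟨h₁, h₀⟩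
  exact ⟨s, hs.1, h⟩

/-- The data of a damped second order flow `p̈ + η ṗ + ∇V(p) = 0` for a quadratic functional
`V(p) = ½ ‖S(p)‖²`, with velocity `q`, acceleration `a`, residual `S` and comparison point `pd`
of residual `Sd`. -/
structure IsDampedFlow {P K : Type*} [NormedAddCommGroup P] [InnerProductSpace ℝ P]
    [NormedAddCommGroup K] [InnerProductSpace ℝ K] (t₀ : ℝ) (η : ℝ → ℝ) (p q a : ℝ → P)
    (S : ℝ → K) (pd : P) (Sd : K) : Prop where
  cont_pos : ContinuousOn p (Ici t₀)
  cont_vel : ContinuousOn q (Ici t₀)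
  deriv_pos : ∀ t, t₀ < t → HasDerivAt p (q t) t
  deriv_vel : ∀ t, t₀ < t → HasDerivAt q (a t) t
  lipschitz : ∃ C : ℝ, ∀ s, t₀ ≤ s → ∀ t, t₀ ≤ t → ‖S s - S t‖ ≤ C * ‖p s - p t‖
  gradient : ∀ t, t₀ < t → ∀ s, t₀ ≤ s →
    inner ℝ (S t) (S s - S t) = -inner ℝ (a t + η t • q t) (p s - p t)
  comparison : ∀ t, t₀ < t →
    inner ℝ (S t) (Sd - S t) = -inner ℝ (a t + η t • q t) (pd - p t)

namespace IsDampedFlow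

variable {P K : Type*} [NormedAddCommGroup P] [InnerProductSpace ℝ P]
    [NormedAddCommGroup K] [InnerProductSpace ℝ K] {t₀ : ℝ} {η : ℝ → ℝ} {p q a : ℝ → P}
    {S : ℝ → K} {pd : P} {Sd : K}

lemma continuousOn_residual (h : IsDampedFlow t₀ η p q a S pd Sd) : ContinuousOn S (Ici t₀) := by
  obtain ⟨C, hC⟩ := h.lipschitz
  intro t ht
  refine tendsto_iff_norm_sub_tendsto_zero.2 ?_
  have h1 : Tendsto (fun s => C * ‖p s - p t‖) (𝓝[Ici t₀] t) (𝓝 0) := by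
    simpa using (tendsto_iff_norm_sub_tendsto_zero.1 (h.cont_pos t ht)).const_mul C
  refine squeeze_zero' (Eventually.of_forall fun s => norm_nonneg _) ?_ h1
  filter_upwards [self_mem_nhdsWithin] with s hs using hC s hs t ht

/-- Differentiability of `S` itself is not needed: in the expansion of `‖S s‖²` around `S t` the
linear term is given by the gradient identity, and the quadratic one is `O((s - t)²)` by the
Lipschitz bound. -/
lemma hasDerivAt_residual_sq (h : IsDampedFlow t₀ η p q a S pd Sd) {t : ℝ} (ht : t₀ < t) :
    HasDerivAt (fun s => ‖S s‖ ^ 2) (-2 * inner ℝ (a t + η t • q t) (q t)) t := by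
  obtain ⟨C, hC⟩ := h.lipschitz
  have hev : ∀ᶠ s in 𝓝 t, t₀ ≤ s := (lt_mem_nhds ht).mono fun s hs => le_of_lt hs
  have hp := h.deriv_pos t ht
  have h1 : HasDerivAt (fun s => -2 * inner ℝ (a t + η t • q t) (p s - p t))
      (-2 * inner ℝ (a t + η t • q t) (q t)) t := by
    have := ((hasDerivAt_const t (a t + η t • q t)).inner ℝ (hp.sub_const (p t))).const_mul (-2)
    simpa using this
  have h2 : HasDerivAt (fun s => ‖S s - S t‖ ^ 2) 0 t := by
    rw [hasDerivAt_iff_isLittleO]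
    have hO : (fun s => p s - p t) =O[𝓝 t] fun s => s - t := hp.isBigO_sub
    have hS : (fun s => S s - S t) =O[𝓝 t] fun s => p s - p t :=
      Asymptotics.IsBigO.of_bound C (hev.mono fun s hs => hC s hs t ht.le)
    have h3 : (fun s => ‖S s - S t‖ ^ 2) =O[𝓝 t] fun s => (s - t) ^ 2 :=
      ((hS.trans hO).norm_left).pow 2
    have h4 : (fun s : ℝ => (s - t) ^ 2) =o[𝓝 t] fun s => s - t := by
      have : Tendsto (fun s : ℝ => s - t) (𝓝 t) (𝓝 0) := by
        simpa using (continuous_id.sub continuous_const).tendsto (x := t) (f := fun s : ℝ => s - t)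
      exact (Asymptotics.isLittleO_pow_id one_lt_two).comp_tendsto this
    simpa using h3.trans_isLittleO h4
  have h5 := ((h1.add h2).add_const (‖S t‖ ^ 2))
  rw [add_zero] at h5
  refine h5.congr_of_eventuallyEq ?_
  filter_upwards [hev] with s hs
  have h6 := h.gradient t ht s hs
  have h7 : ‖S s‖ ^ 2 = ‖S t‖ ^ 2 + 2 * inner ℝ (S t) (S s - S t) + ‖S s - S t‖ ^ 2 := by
    rw [← norm_add_sq_real, add_sub_cancel]
  simp only [Pi.add_apply]
  linarith

lemma hasDerivAt_energy (h : IsDampedFlow t₀ η p q a S pd Sd) {t : ℝ} (ht : t₀ < t) :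
    HasDerivAt (fun s => ‖S s‖ ^ 2 + ‖q s‖ ^ 2) (-2 * η t * ‖q t‖ ^ 2) t := by
  refine ((h.hasDerivAt_residual_sq ht).add (h.deriv_vel t ht).norm_sq).congr_deriv ?_
  rw [inner_add_left, real_inner_smul_left, real_inner_self_eq_norm_sq, real_inner_comm]
  ring

lemma continuousOn_energy (h : IsDampedFlow t₀ η p q a S pd Sd) :
    ContinuousOn (fun s => ‖S s‖ ^ 2 + ‖q s‖ ^ 2) (Ici t₀) :=
  (h.continuousOn_residual.norm.pow 2).add (h.cont_vel.norm.pow 2)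

/-- Convexity of `V`: expand `‖Sd‖²` around `S t` and drop the square `‖Sd - S t‖²`. -/
lemma inner_force_le (h : IsDampedFlow t₀ η p q a S pd Sd) {t : ℝ} (ht : t₀ < t) :
    inner ℝ (a t + η t • q t) (p t - pd) ≤ (‖Sd‖ ^ 2 - ‖S t‖ ^ 2) / 2 := by
  have h1 := h.comparison t ht
  have h2 : ‖Sd‖ ^ 2 = ‖S t‖ ^ 2 + 2 * inner ℝ (S t) (Sd - S t) + ‖Sd - S t‖ ^ 2 := by
    rw [← norm_add_sq_real, add_sub_cancel]
  rw [← neg_sub pd, inner_neg_right]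
  nlinarith [sq_nonneg ‖Sd - S t‖]

lemma hasDerivAt_inner (h : IsDampedFlow t₀ η p q a S pd Sd) {t : ℝ} (ht : t₀ < t) :
    HasDerivAt (fun s => inner ℝ (q s) (p s - pd))
      (‖q t‖ ^ 2 + inner ℝ (a t) (p t - pd)) t := by
  refine ((h.deriv_vel t ht).inner ℝ ((h.deriv_pos t ht).sub_const pd)).congr_deriv ?_
  rw [real_inner_self_eq_norm_sq]

lemma hasDerivAt_dist_sq (h : IsDampedFlow t₀ η p q a S pd Sd) {t : ℝ} (ht : t₀ < t) :
    HasDerivAt (fun s => ‖p s - pd‖ ^ 2) (2 * inner ℝ (q t) (p t - pd)) t := by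
  refine ((h.deriv_pos t ht).sub_const pd).norm_sq.congr_deriv ?_
  rw [real_inner_comm]

lemma continuousOn_inner (h : IsDampedFlow t₀ η p q a S pd Sd) :
    ContinuousOn (fun s => inner ℝ (q s) (p s - pd)) (Ici t₀) :=
  h.cont_vel.inner (h.cont_pos.sub continuousOn_const)

lemma continuousOn_dist_sq (h : IsDampedFlow t₀ η p q a S pd Sd) :
    ContinuousOn (fun s => ‖p s - pd‖ ^ 2) (Ici t₀) :=
  (h.cont_pos.sub continuousOn_const).norm.pow 2

/-- For constant damping the energy falls below every level above that of the comparison point. -/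
lemma exists_energy_lt_of_const {k : ℝ} (hk : 0 < k)
    (h : IsDampedFlow t₀ (fun _ => k) p q a S pd Sd) {c : ℝ} (hc : ‖Sd‖ ^ 2 < c) :
    ∃ T, t₀ ≤ T ∧ ‖S T‖ ^ 2 + ‖q T‖ ^ 2 < c := by
  by_contra! hcon
  set ε := (c - ‖Sd‖ ^ 2) / 2 with hε
  have hε0 : 0 < ε := by rw [hε]; linarith
  -- The first two terms differentiate to `‖q‖² + ⟨a + k q, p - pd⟩`. The weight `3 / (4k)` turns
  -- `‖q‖²` into `-‖q‖² / 2`, so that by `inner_force_le` the derivative is at most `(‖Sd‖² - E) / 2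
  -- ≤ -ε`. It also exceeds `1 / (2k)`, the least weight for which completing the square gives `G ≥
  -- 0`.
  set G : ℝ → ℝ := fun t => inner ℝ (q t) (p t - pd) + k / 2 * ‖p t - pd‖ ^ 2
    + 3 / (4 * k) * (‖S t‖ ^ 2 + ‖q t‖ ^ 2) with hG
  have hG0 : ∀ t, 0 ≤ G t := by
    intro t
    have h1 := neg_le_of_abs_le (abs_real_inner_le_norm (q t) (p t - pd))
    have h2 : k / 2 * ‖p t - pd‖ ^ 2 - ‖q t‖ * ‖p t - pd‖ + 3 / (4 * k) * ‖q t‖ ^ 2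
        = k / 2 * (‖p t - pd‖ - ‖q t‖ / k) ^ 2 + 1 / (4 * k) * ‖q t‖ ^ 2 := by
      field_simp; ring
    have h3 : 0 ≤ k / 2 * (‖p t - pd‖ - ‖q t‖ / k) ^ 2 + 1 / (4 * k) * ‖q t‖ ^ 2 := by positivity
    have h4 : 0 ≤ 3 / (4 * k) * ‖S t‖ ^ 2 := by positivity
    simp only [hG]
    linarith
  have hanti : AntitoneOn (fun t => G t + ε * t) (Ici t₀) := by
    refine antitoneOn_Ici_of_hasDerivAt (f' := fun t => (‖q t‖ ^ 2 + inner ℝ (a t) (p t - pd))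
      + k / 2 * (2 * inner ℝ (q t) (p t - pd)) + 3 / (4 * k) * (-2 * k * ‖q t‖ ^ 2) + ε * 1)
      ?_ ?_ ?_
    · exact ((h.continuousOn_inner.add (continuousOn_const.mul h.continuousOn_dist_sq)).add
        (continuousOn_const.mul h.continuousOn_energy)).add (by fun_prop)
    · intro t ht
      exact (((h.hasDerivAt_inner ht).add ((h.hasDerivAt_dist_sq ht).const_mul _)).add
        ((h.hasDerivAt_energy ht).const_mul _)).add ((hasDerivAt_id t).const_mul ε)
    · intro t ht
      have h1 := h.inner_force_le ht
      have h2 := hcon t ht.le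
      rw [inner_add_left, real_inner_smul_left] at h1
      have h3 : 3 / (4 * k) * (-2 * k * ‖q t‖ ^ 2) = -(3 / 2) * ‖q t‖ ^ 2 := by
        field_simp; ring
      simp only [h3]
      linarith
  -- Beyond this time the bound `G T ≤ G t₀ + ε t₀ - ε T` is negative.
  set T := max t₀ ((G t₀ + ε * t₀) / ε + 1)
  have h1 := hanti (mem_Ici.2 le_rfl) (mem_Ici.2 (le_max_left t₀ _ : t₀ ≤ T)) (le_max_left _ _)
  have h2 : (G t₀ + ε * t₀) / ε + 1 ≤ T := le_max_right _ _
  have h3 : (G t₀ + ε * t₀) / ε < T := by linarith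
  rw [div_lt_iff₀ hε0] at h3
  have := hG0 T
  simp only at h1
  linarith

/-- For the vanishing damping `r / t` the energy falls below every level above that of the
comparison point. -/
lemma exists_energy_lt_of_vanishing {r : ℝ} (hr : 0 < r)
    (h : IsDampedFlow 1 (fun t => r / t) p q a S pd Sd) {c : ℝ} (hc : ‖Sd‖ ^ 2 < c) :
    ∃ T, 1 ≤ T ∧ ‖S T‖ ^ 2 + ‖q T‖ ^ 2 < c := by
  by_contra! hcon
  set ε := (c - ‖Sd‖ ^ 2) / 2 with hε
  have hε0 : 0 < ε := by rw [hε]; linarith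
  -- The previous function with weights in `1 / t`. The coefficient `r + 1` in place of `r` absorbs
  -- the derivative of the factor `t⁻¹`, and differentiating `(t²)⁻¹` contributes a term of
  -- favourable sign. The decrease is now at least `ε / t`.
  set G : ℝ → ℝ := fun t => t⁻¹ * inner ℝ (q t) (p t - pd)
    + (t ^ 2)⁻¹ * ((r + 1) / 2 * ‖p t - pd‖ ^ 2)
    + 3 / (4 * r) * (‖S t‖ ^ 2 + ‖q t‖ ^ 2) with hG
  have hG0 : ∀ t, 1 ≤ t → 0 ≤ G t := by
    intro t ht
    have ht0 : 0 < t := by linarith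
    have h1 := neg_le_of_abs_le (abs_real_inner_le_norm (q t) (p t - pd))
    have h1' := mul_le_mul_of_nonneg_left h1 (inv_pos.2 ht0).le
    have h2 : (t ^ 2)⁻¹ * ((r + 1) / 2 * ‖p t - pd‖ ^ 2) - t⁻¹ * (‖q t‖ * ‖p t - pd‖)
        + 3 / (4 * r) * ‖q t‖ ^ 2
        = r / 2 * (t⁻¹ * ‖p t - pd‖ - ‖q t‖ / r) ^ 2 + 1 / (4 * r) * ‖q t‖ ^ 2
          + (t⁻¹ * ‖p t - pd‖) ^ 2 / 2 := by
      field_simp; ring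
    have h3 : 0 ≤ r / 2 * (t⁻¹ * ‖p t - pd‖ - ‖q t‖ / r) ^ 2 + 1 / (4 * r) * ‖q t‖ ^ 2
          + (t⁻¹ * ‖p t - pd‖) ^ 2 / 2 := by positivity
    have h4 : 0 ≤ 3 / (4 * r) * ‖S t‖ ^ 2 := by positivity
    simp only [hG]
    linarith
  have hanti : AntitoneOn (fun t => G t + ε * Real.log t) (Ici 1) := by
    refine antitoneOn_Ici_of_hasDerivAt (f' := fun t =>
      (-(t ^ 2)⁻¹ * inner ℝ (q t) (p t - pd) + t⁻¹ * (‖q t‖ ^ 2 + inner ℝ (a t) (p t - pd)))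
      + (-(2 * t) / (t ^ 2) ^ 2 * ((r + 1) / 2 * ‖p t - pd‖ ^ 2)
        + (t ^ 2)⁻¹ * ((r + 1) / 2 * (2 * inner ℝ (q t) (p t - pd))))
      + 3 / (4 * r) * (-2 * (r / t) * ‖q t‖ ^ 2) + ε * t⁻¹) ?_ ?_ ?_
    · have hne : ∀ t ∈ Ici (1 : ℝ), t ≠ 0 := fun t ht => by
        have : (1 : ℝ) ≤ t := ht
        linarith
      have hi : ContinuousOn (fun t : ℝ => t⁻¹) (Ici 1) := continuousOn_id.inv₀ hne
      have hi2 : ContinuousOn (fun t : ℝ => (t ^ 2)⁻¹) (Ici 1) :=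
        (continuousOn_id.pow 2).inv₀ fun t ht => pow_ne_zero 2 (hne t ht)
      have hl : ContinuousOn (fun t : ℝ => Real.log t) (Ici 1) := continuousOn_id.log hne
      exact (((hi.mul h.continuousOn_inner).add
        (hi2.mul (continuousOn_const.mul h.continuousOn_dist_sq))).add
        (continuousOn_const.mul h.continuousOn_energy)).add (continuousOn_const.mul hl)
    · intro t ht
      have ht0 : t ≠ 0 := by linarith
      have hi2 : HasDerivAt (fun t : ℝ => (t ^ 2)⁻¹) (-(2 * t) / (t ^ 2) ^ 2) t := by
        have := (hasDerivAt_pow 2 t).inv (pow_ne_zero 2 ht0)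
        simpa only [Nat.cast_ofNat, Nat.add_one_sub_one, pow_one] using! this
      exact ((((hasDerivAt_inv ht0).mul (h.hasDerivAt_inner ht)).add
        (hi2.mul ((h.hasDerivAt_dist_sq ht).const_mul _))).add
        ((h.hasDerivAt_energy ht).const_mul _)).add ((Real.hasDerivAt_log ht0).const_mul ε)
    · intro t ht
      have ht0 : 0 < t := by linarith
      have h1 := h.inner_force_le ht
      have h2 := hcon t ht.le
      rw [inner_add_left, real_inner_smul_left] at h1
      have h3 : (-(t ^ 2)⁻¹ * inner ℝ (q t) (p t - pd)
          + t⁻¹ * (‖q t‖ ^ 2 + inner ℝ (a t) (p t - pd)))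
        + (-(2 * t) / (t ^ 2) ^ 2 * ((r + 1) / 2 * ‖p t - pd‖ ^ 2)
        + (t ^ 2)⁻¹ * ((r + 1) / 2 * (2 * inner ℝ (q t) (p t - pd))))
        + 3 / (4 * r) * (-2 * (r / t) * ‖q t‖ ^ 2) + ε * t⁻¹
        = t⁻¹ * (inner ℝ (a t) (p t - pd) + r / t * inner ℝ (q t) (p t - pd)
          - ‖q t‖ ^ 2 / 2 + ε - (r + 1) * (t⁻¹ * ‖p t - pd‖) ^ 2) := by
        field_simp; ring
      simp only [h3]
      refine mul_nonpos_of_nonneg_of_nonpos (inv_pos.2 ht0).le ?_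
      have h4 : 0 ≤ (r + 1) * (t⁻¹ * ‖p t - pd‖) ^ 2 := by positivity
      linarith
  obtain ⟨T, hT1, hT⟩ : ∃ T, 1 ≤ T ∧ G 1 / ε < Real.log T :=
    ((eventually_ge_atTop 1).and (Real.tendsto_log_atTop.eventually_gt_atTop _)).exists
  have h1 := hanti (mem_Ici.2 le_rfl) (mem_Ici.2 hT1) hT1
  rw [div_lt_iff₀ hε0] at hT
  have := hG0 T hT1
  simp only [Real.log_one, mul_zero, add_zero] at h1
  linarith

lemma exists_energy_lt (hη : IsDamping t₀ η) (h : IsDampedFlow t₀ η p q a S pd Sd) {c : ℝ}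
    (hc : ‖Sd‖ ^ 2 < c) : ∃ T, t₀ ≤ T ∧ ‖S T‖ ^ 2 + ‖q T‖ ^ 2 < c := by
  rcases hη with ⟨rfl, k, hk, rfl⟩ | ⟨rfl, r, hr, rfl⟩
  · exact h.exists_energy_lt_of_const hk hc
  · exact h.exists_energy_lt_of_vanishing hr hc

lemma damping_pos (hη : IsDamping t₀ η) {t : ℝ} (ht : t₀ < t) : 0 < η t := by
  rcases hη with ⟨rfl, k, hk, rfl⟩ | ⟨rfl, r, hr, rfl⟩
  · exact hk
  · exact div_pos hr (by linarith)

lemma antitoneOn_energy (hη : IsDamping t₀ η) (h : IsDampedFlow t₀ η p q a S pd Sd) :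
    AntitoneOn (fun s => ‖S s‖ ^ 2 + ‖q s‖ ^ 2) (Ici t₀) := by
  refine antitoneOn_Ici_of_hasDerivAt h.continuousOn_energy (fun t ht => h.hasDerivAt_energy ht) ?_
  intro t ht
  have h1 : 0 ≤ 2 * η t * ‖q t‖ ^ 2 := by have := damping_pos hη ht; positivity
  linarith

/-- Above the level of the comparison point the energy is injective. -/
lemma energy_ne (hη : IsDamping t₀ η) (h : IsDampedFlow t₀ η p q a S pd Sd) {c T₁ T₂ : ℝ}
    (hc : ‖Sd‖ ^ 2 < c) (h₁ : t₀ ≤ T₁) (hlt : T₁ < T₂) (hE₁ : ‖S T₁‖ ^ 2 + ‖q T₁‖ ^ 2 = c)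
    (hE₂ : ‖S T₂‖ ^ 2 + ‖q T₂‖ ^ 2 = c) : False := by
  have hanti := h.antitoneOn_energy hη
  have hE : ∀ t ∈ Ioo T₁ T₂, ‖S t‖ ^ 2 + ‖q t‖ ^ 2 = c := by
    intro t ht
    have ht0 : t ∈ Ici t₀ := mem_Ici.2 (h₁.trans ht.1.le)
    have a1 := hanti (mem_Ici.2 h₁) ht0 ht.1.le
    have a2 := hanti ht0 (mem_Ici.2 (h₁.trans hlt.le)) ht.2.le
    simp only at a1 a2
    linarith
  have hq : ∀ t ∈ Ioo T₁ T₂, q t = 0 := by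
    intro t ht
    have ht0 : t₀ < t := h₁.trans_lt ht.1
    have e : (fun s => ‖S s‖ ^ 2 + ‖q s‖ ^ 2) =ᶠ[𝓝 t] fun _ => c := by
      filter_upwards [isOpen_Ioo.mem_nhds ht] with s hs using hE s hs
    -- On the plateau the dissipation `2 η ‖q‖²` vanishes, and `η > 0` leaves only `q = 0`.
    have e1 := (h.hasDerivAt_energy ht0).unique ((hasDerivAt_const t c).congr_of_eventuallyEq e)
    have := damping_pos hη ht0
    have e2 : ‖q t‖ ^ 2 = 0 := by
      rcases mul_eq_zero.1 e1 with h' | h'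
      · linarith
      · exact h'
    simpa using e2
  obtain ⟨t, ht⟩ := exists_between hlt
  have ht' : t ∈ Ioo T₁ T₂ := ht
  have ht0 : t₀ < t := h₁.trans_lt ht.1
  have e : q =ᶠ[𝓝 t] fun _ => (0 : P) := by
    filter_upwards [isOpen_Ioo.mem_nhds ht'] with s hs using hq s hs
  -- With `q` and `a` both zero the force vanishes, so `inner_force_le` gives `‖S t‖ ≤ ‖Sd‖`.
  have ha : a t = 0 :=
    (h.deriv_vel t ht0).unique ((hasDerivAt_const t (0 : P)).congr_of_eventuallyEq e)
  have e3 := h.inner_force_le ht0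
  have e4 := hE t ht'
  rw [ha, hq t ht'] at e3
  rw [hq t ht'] at e4
  simp at e3 e4
  linarith

/-- The residual need not be monotone, but its square is at most the energy, which falls below `b²`.
-/
lemma exists_residual_eq (hη : IsDamping t₀ η) (h : IsDampedFlow t₀ η p q a S pd Sd) {b : ℝ}
    (hb : ‖Sd‖ < b) (h₀ : b ≤ ‖S t₀‖) : ∃ T, t₀ ≤ T ∧ ‖S T‖ - b = 0 := by
  have hb0 : 0 < b := (norm_nonneg _).trans_lt hb
  obtain ⟨T, hT, hlt⟩ := h.exists_energy_lt hη (c := b ^ 2)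
    (pow_lt_pow_left₀ hb (norm_nonneg _) two_ne_zero)
  refine exists_root_Ici (h.continuousOn_residual.norm.sub continuousOn_const) hT
    (by simpa using h₀) ?_
  have : ‖S T‖ < b := lt_of_pow_lt_pow_left₀ 2 hb0.le (by nlinarith [sq_nonneg ‖q T‖])
  simpa using this.le

lemma existsUnique_energy_eq (hη : IsDamping t₀ η) (h : IsDampedFlow t₀ η p q a S pd Sd) {c : ℝ}
    (hc : ‖Sd‖ ^ 2 < c) (h₀ : c ≤ ‖S t₀‖ ^ 2 + ‖q t₀‖ ^ 2) :
    ∃! T, t₀ ≤ T ∧ ‖S T‖ ^ 2 + ‖q T‖ ^ 2 - c = 0 := by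
  obtain ⟨T, hT, hlt⟩ := h.exists_energy_lt hη hc
  obtain ⟨s, hs, hs0⟩ := exists_root_Ici (h.continuousOn_energy.sub (continuousOn_const (c := c)))
    hT (by simpa using h₀) (by simpa using hlt.le)
  refine ⟨s, ⟨hs, hs0⟩, ?_⟩
  replace hs0 : ‖S s‖ ^ 2 + ‖q s‖ ^ 2 - c = 0 := hs0
  rintro s' ⟨hs', hs0'⟩
  rcases lt_trichotomy s' s with hl | hl | hl
  · exact (h.energy_ne hη hc hs' hl (by linarith) (by linarith)).elim
  · exact hl
  · exact (h.energy_ne hη hc hs hl (by linarith) (by linarith)).elim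

end IsDampedFlow

end InverseSource

/-! ### Finiteness of the surface measure. -/

namespace InverseSource

/-- A subset of a bounded set on which a linear map into `ℝⁿ` is antilipschitz has finite
`n`-dimensional Hausdorff measure. -/
lemma hausdorffMeasure_lt_top_of_antilipschitz {X : Type*} [NormedAddCommGroup X]
    [NormedSpace ℝ X] [MeasurableSpace X] [BorelSpace X] {n : ℕ} (f : X →L[ℝ] (Fin n → ℝ))
    {s : Set X} (hs : Bornology.IsBounded s) {C : NNReal}
    (h : ∀ x ∈ s, ∀ y ∈ s, ‖x - y‖ ≤ C * ‖f (x - y)‖) : Measure.hausdorffMeasure n s < ⊤ := by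
  set g : s → (Fin n → ℝ) := fun x => f x
  have hg : AntilipschitzWith C g := by
    refine AntilipschitzWith.of_le_mul_dist fun x y => ?_
    rw [Subtype.dist_eq, dist_eq_norm, dist_eq_norm, ← map_sub]
    exact h x x.2 y y.2
  have h1 : Measure.hausdorffMeasure (n : ℝ) s
      = Measure.hausdorffMeasure (n : ℝ) (univ : Set s) := by
    rw [← (isometry_subtype_coe (s := s)).hausdorffMeasure_image (Or.inl n.cast_nonneg) univ]
    simp
  rw [h1]
  refine (hg.le_hausdorffMeasure_image n.cast_nonneg univ).trans_lt ?_
  have h2 : Bornology.IsBounded (g '' univ) := by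
    refine (f.lipschitz.isBounded_image hs).subset ?_
    rintro _ ⟨x, -, rfl⟩
    exact ⟨x, x.2, rfl⟩
  have h3 : (Measure.hausdorffMeasure (n : ℝ) : Measure (Fin n → ℝ)) = volume := by
    have := hausdorffMeasure_pi_real (ι := Fin n)
    rwa [Fintype.card_fin] at this
  rw [h3]
  exact ENNReal.mul_lt_top (ENNReal.rpow_lt_top_of_nonneg n.cast_nonneg ENNReal.coe_ne_top)
    h2.measure_lt_top

/-- A non-zero functional on `ℝⁿ⁺¹` is complemented by a linear map into `ℝⁿ`. -/
lemma exists_complement_of_ne_zero {X : Type*} [NormedAddCommGroup X] [NormedSpace ℝ X]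
    [FiniteDimensional ℝ X] {n : ℕ} (hn : Module.finrank ℝ X = n + 1) {L : X →L[ℝ] ℝ}
    (hL : L ≠ 0) :
    ∃ (f : X →L[ℝ] (Fin n → ℝ)) (A B : NNReal), ∀ x, ‖x‖ ≤ A * ‖f x‖ + B * ‖L x‖ := by
  obtain ⟨v, hv⟩ : ∃ v, L v = 1 := by
    obtain ⟨w, hw⟩ : ∃ w, L w ≠ 0 := by
      by_contra! h
      exact hL (ContinuousLinearMap.ext h)
    exact ⟨(L w)⁻¹ • w, by simp [hw]⟩
  have hr : Module.finrank ℝ (LinearMap.ker (L : X →ₗ[ℝ] ℝ)) = n := by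
    have h1 := LinearMap.finrank_range_add_finrank_ker (L : X →ₗ[ℝ] ℝ)
    have h2 : LinearMap.range (L : X →ₗ[ℝ] ℝ) = ⊤ := by
      rw [LinearMap.range_eq_top]
      exact fun c => ⟨c • v, by simp [hv]⟩
    rw [h2, finrank_top, Module.finrank_self, hn] at h1
    omega
  let e : LinearMap.ker (L : X →ₗ[ℝ] ℝ) ≃L[ℝ] (Fin n → ℝ) :=
    ContinuousLinearEquiv.ofFinrankEq (by simp [hr])
  -- The projection onto `ker L` along `v`.
  let π : X →ₗ[ℝ] LinearMap.ker (L : X →ₗ[ℝ] ℝ) :=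
    LinearMap.codRestrict _ (LinearMap.id - (L : X →ₗ[ℝ] ℝ).smulRight v) (by
      intro x
      simp [hv])
  refine ⟨e.toContinuousLinearMap.comp (LinearMap.toContinuousLinearMap π),
    ‖e.symm.toContinuousLinearMap‖₊, ‖v‖₊, fun x => ?_⟩
  have h1 : x = (π x : X) + L x • v := (sub_add_cancel x (L x • v)).symm
  have h2 : ‖(π x : X)‖ ≤ ‖e.symm.toContinuousLinearMap‖ * ‖e (π x)‖ := by
    have := e.symm.toContinuousLinearMap.le_opNorm (e (π x))
    simpa using this
  calc ‖x‖ ≤ ‖(π x : X)‖ + ‖L x • v‖ := by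
        conv_lhs => rw [h1]
        exact norm_add_le _ _
    _ ≤ _ := by
        rw [norm_smul, mul_comm ‖L x‖]
        exact add_le_add h2 le_rfl

/-- The zero set of a function with non-vanishing differential has locally finite
`n`-dimensional Hausdorff measure in dimension `n + 1`. -/
lemma exists_nhds_hausdorffMeasure_lt_top {X : Type*} [NormedAddCommGroup X] [NormedSpace ℝ X]
    [FiniteDimensional ℝ X] [MeasurableSpace X] [BorelSpace X] {n : ℕ}
    (hn : Module.finrank ℝ X = n + 1) {ρ : X → ℝ} {L : X →L[ℝ] ℝ} {x : X}
    (hρ : HasStrictFDerivAt ρ L x) (hL : L ≠ 0) :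
    ∃ s ∈ 𝓝 x, Measure.hausdorffMeasure n (s ∩ ρ ⁻¹' {0}) < ⊤ := by
  obtain ⟨f, A, B, hf⟩ := exists_complement_of_ne_zero hn hL
  -- On the zero set `‖L (y - z)‖` is at most this constant times `‖y - z‖`. The choice makes `B ‖L
  -- (y - z)‖ ≤ ‖y - z‖ / 2`, which is absorbed on the left and leaves `‖y - z‖ ≤ 2 A ‖f (y - z)‖`;
  -- the `+ 1` covers `B = 0`.
  obtain ⟨s, hs, happ⟩ := hρ.approximates_deriv_on_nhds (c := (2 * (B + 1))⁻¹)
    (Or.inr (by positivity))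
  refine ⟨s ∩ Metric.ball x 1, inter_mem hs (Metric.ball_mem_nhds x one_pos), ?_⟩
  refine hausdorffMeasure_lt_top_of_antilipschitz f (C := 2 * A)
    (Metric.isBounded_ball.subset fun y hy => hy.1.2) ?_
  rintro y ⟨⟨hy, -⟩, hy0⟩ z ⟨⟨hz, -⟩, hz0⟩
  have h1 := happ y hy z hz
  rw [mem_preimage, mem_singleton_iff] at hy0 hz0
  rw [hy0, hz0, sub_zero, zero_sub, norm_neg] at h1
  have h2 := hf (y - z)
  have h3 : (B : ℝ) * ‖L (y - z)‖ ≤ ‖y - z‖ / 2 := by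
    have hB : (0 : ℝ) < B + 1 := by positivity
    calc (B : ℝ) * ‖L (y - z)‖ ≤ (B + 1) * ‖L (y - z)‖ := by gcongr; linarith
      _ ≤ (B + 1) * (((2 * (B + 1))⁻¹ : NNReal) * ‖y - z‖) := by gcongr
      _ = ‖y - z‖ / 2 := by push_cast; field_simp
  push_cast
  linarith

lemma IsSmoothBoundedDomain.surface_univ_lt_top {d : ℕ} (hd : 1 ≤ d) {Ω : Set (E d)}
    (hΩ : IsSmoothBoundedDomain Ω) : surface Ω univ < ⊤ := by
  obtain ⟨n, rfl⟩ : ∃ n, d = n + 1 := ⟨d - 1, by omega⟩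
  have hc : IsCompact (frontier Ω) := Metric.isCompact_of_isClosed_isBounded isClosed_frontier
    (hΩ.isBounded.closure.subset frontier_subset_closure)
  have hH : Measure.hausdorffMeasure (n : ℝ) (frontier Ω) < ⊤ := by
    refine hc.measure_lt_top_of_nhdsWithin fun x hx => ?_
    obtain ⟨ρ, hρ, hρx, hev⟩ := hΩ.smooth_boundary x hx
    obtain ⟨s, hs, hlt⟩ := exists_nhds_hausdorffMeasure_lt_top (n := n) (by simp)
      (hρ.contDiffAt.hasStrictFDerivAt (by simp)) hρx
    obtain ⟨U, hU, hUo, hxU⟩ := mem_nhds_iff.1 hev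
    refine ⟨frontier Ω ∩ (s ∩ U), inter_mem self_mem_nhdsWithin
      (mem_nhdsWithin_of_mem_nhds (inter_mem hs (hUo.mem_nhds hxU))),
      (measure_mono ?_).trans_lt hlt⟩
    -- A boundary point is a zero of `ρ`: where `ρ > 0` a whole neighbourhood misses `Ω`, and where
    -- `ρ < 0` the point lies in the open set `Ω`.
    rintro y ⟨hy, hys, hyU⟩
    refine ⟨hys, le_antisymm ?_ ?_⟩
    · by_contra! hpos
      have h1 : ∀ᶠ z in 𝓝 y, 0 < ρ z ∧ z ∈ U :=
        (hρ.continuous.continuousAt.eventually (lt_mem_nhds hpos)).and (hUo.mem_nhds hyU)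
      obtain ⟨z, ⟨hz1, hz2⟩, hz3⟩ := mem_closure_iff_nhds.1 (frontier_subset_closure hy) _ h1
      exact absurd ((hU hz2).1 hz3) (not_lt.2 hz1.le)
    · by_contra! hneg
      have h1 : y ∈ Ω := (hU hyU).2 hneg
      rw [hΩ.isOpen.frontier_eq] at hy
      exact hy.2 h1
  rw [surface, Measure.restrict_apply_univ, Measure.euclideanHausdorffMeasure_def,
    Measure.smul_apply, Nat.add_sub_cancel]
  exact ENNReal.mul_lt_top ENNReal.coe_lt_top hH

end InverseSource

/-! ### Sobolev functions and the closed graph of the trace relation. -/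

namespace InverseSource

noncomputable section

variable {d : ℕ}

section LpDistance

variable {X : Type*} [MeasurableSpace X] {μ : Measure X} {F F' : Type*} [NormedAddCommGroup F]
  [NormedAddCommGroup F']

lemma eLpNorm_add_sub_coeFn_add_le {f g : X → F} (hf : AEStronglyMeasurable f μ)
    (hg : AEStronglyMeasurable g μ) (a b : Lp F 2 μ) :
    eLpNorm (fun x => (f x + g x) - (a + b : Lp F 2 μ) x) 2 μ ≤
      eLpNorm (fun x => f x - a x) 2 μ + eLpNorm (fun x => g x - b x) 2 μ := by
  refine (eLpNorm_congr_ae ?_).trans_le (eLpNorm_add_le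
    (hf.sub (Lp.aestronglyMeasurable a)) (hg.sub (Lp.aestronglyMeasurable b)) one_le_two)
  filter_upwards [Lp.coeFn_add a b] with x hx
  rw [hx]
  simp only [Pi.add_apply]
  abel

lemma eLpNorm_sub_coeFn_le {f : X → F} (hf : AEStronglyMeasurable f μ) (a b : Lp F 2 μ) :
    eLpNorm (fun x => f x - b x) 2 μ ≤ eLpNorm (fun x => f x - a x) 2 μ + ‖a - b‖ₑ := by
  have h := eLpNorm_add_le (μ := μ) (hf.sub (Lp.aestronglyMeasurable a))
    (Lp.aestronglyMeasurable (a - b)) one_le_two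
  rw [Lp.enorm_def]
  refine (eLpNorm_congr_ae ?_).trans_le h
  filter_upwards [Lp.coeFn_sub a b] with x hx
  simp only [Pi.add_apply, hx, Pi.sub_apply]
  abel

lemma eLpNorm_comp_sub_compLp_le [NormedSpace ℝ F] [NormedSpace ℝ F'] (L : F →L[ℝ] F')
    (f : X → F) (a : Lp F 2 μ) :
    eLpNorm (fun x => L (f x) - L.compLp a x) 2 μ ≤
      ‖L‖ₑ * eLpNorm (fun x => f x - a x) 2 μ := by
  refine eLpNorm_le_mul_eLpNorm_of_ae_le_mul' (c := ‖L‖₊) ?_ 2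
  filter_upwards [L.coeFn_compLp a] with x hx
  rw [hx, ← map_sub]
  exact L.le_opENorm _

end LpDistance

section Maps

variable {𝕜 𝕜' : Type} [RCLike 𝕜] [RCLike 𝕜']

lemma integral_mul_compLp (L : 𝕜 →L[ℝ] 𝕜') {G : Set (E d)} {φ : E d → ℝ} (hc : Continuous φ)
    (hs : HasCompactSupport φ) (u : L2 𝕜 G) :
    ∫ x in G, (φ x : 𝕜') * (L.compLp u) x = L (∫ x in G, (φ x : 𝕜) * u x) := by
  rw [← L.integral_comp_comm (memLp_mul_integrable hc hs u)]
  refine integral_congr_ae ?_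
  filter_upwards [L.coeFn_compLp u] with x hx
  rw [hx, ← RCLike.real_smul_eq_coe_mul, ← RCLike.real_smul_eq_coe_mul, map_smul]

/-- The action of a real-linear map between the scalar fields on `H¹(G)`. -/
def H1.map (L : 𝕜 →L[ℝ] 𝕜') {G : Set (E d)} (u : H1 𝕜 G) : H1 𝕜' G :=
  ⟨WithLp.toLp 2 fun o => L.compLp (u.1 o), by
    intro φ hφ i
    change ∫ x in G, ((pderiv i φ x : ℝ) : 𝕜') * L.compLp (u.1 none) x =
      -∫ x in G, ((φ x : ℝ) : 𝕜') * L.compLp (u.1 (some i)) x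
    rw [integral_mul_compLp L (hφ.pderiv_continuous i) (hφ.pderiv_compact i),
      integral_mul_compLp L hφ.smooth.continuous hφ.compact, u.2 φ hφ i, map_neg]⟩

lemma H1.fn_map (L : 𝕜 →L[ℝ] 𝕜') {G : Set (E d)} (u : H1 𝕜 G) :
    H1.fn (H1.map L u) = L.compLp (H1.fn u) := rfl

lemma H1.wd_map (L : 𝕜 →L[ℝ] 𝕜') {G : Set (E d)} (u : H1 𝕜 G) (i : Fin d) :
    H1.wd (H1.map L u) i = L.compLp (H1.wd u i) := rfl

lemma H1.wd_add {G : Set (E d)} (u v : H1 𝕜 G) (i : Fin d) :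
    H1.wd (u + v) i = H1.wd u i + H1.wd v i := rfl

lemma norm_fn_le {G : Set (E d)} (u : H1 𝕜 G) : ‖H1.fn u‖ ≤ ‖u‖ := PiLp.norm_apply_le u.1 none

lemma norm_wd_le {G : Set (E d)} (u : H1 𝕜 G) (i : Fin d) : ‖H1.wd u i‖ ≤ ‖u‖ :=
  PiLp.norm_apply_le u.1 (some i)

lemma pderiv_add {φ ψ : E d → 𝕜} (hφ : ContDiff ℝ ∞ φ) (hψ : ContDiff ℝ ∞ ψ) (i : Fin d)
    (x : E d) : pderiv i (fun y => φ y + ψ y) x = pderiv i φ x + pderiv i ψ x := by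
  have h1 : DifferentiableAt ℝ φ x := hφ.differentiable (by simp) x
  have h2 : DifferentiableAt ℝ ψ x := hψ.differentiable (by simp) x
  simp only [pderiv, fderiv_fun_add h1 h2, add_apply]

lemma pderiv_comp (L : 𝕜 →L[ℝ] 𝕜') {φ : E d → 𝕜} (hφ : ContDiff ℝ ∞ φ) (i : Fin d)
    (x : E d) : pderiv i (fun y => L (φ y)) x = L (pderiv i φ x) := by
  have h1 : DifferentiableAt ℝ φ x := hφ.differentiable (by simp) x
  have h2 := (L.hasFDerivAt.comp x h1.hasFDerivAt).fderiv
  simp only [pderiv]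
  rw [show (fun y => L (φ y)) = L ∘ φ from rfl, h2]
  rfl

lemma continuous_pderiv {φ : E d → 𝕜} (hφ : ContDiff ℝ ∞ φ) (i : Fin d) :
    Continuous (pderiv i φ) :=
  (hφ.continuous_fderiv (by simp)).clm_apply continuous_const

/-- The distance of a smooth function to a pair of a Sobolev function and a boundary function. -/
def traceDist {Ω : Set (E d)} (u : H1 𝕜 Ω) (γ : L2Bd 𝕜 Ω) (φ : E d → 𝕜) : ℝ≥0∞ :=
  eLpNorm (fun x => φ x - H1.fn u x) 2 (volume.restrict Ω)
    + ∑ i, eLpNorm (fun x => pderiv i φ x - H1.wd u i x) 2 (volume.restrict Ω)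
    + eLpNorm (fun x => φ x - γ x) 2 (surface Ω)

/-- All limits in the trace relation are merged into one error, so that sums, linear images and
limits can be treated by an `ε`-argument. -/
lemma hasTrace_iff {Ω : Set (E d)} {u : H1 𝕜 Ω} {γ : L2Bd 𝕜 Ω} :
    HasTrace u γ ↔ ∀ ε : ℝ≥0∞, 0 < ε → ∃ φ : E d → 𝕜, ContDiff ℝ ∞ φ ∧ traceDist u γ φ < ε := by
  constructor
  · rintro ⟨φ, hφ, h0, h1, h2⟩ ε hε
    have h : Tendsto (fun n => traceDist u γ (φ n)) atTop (𝓝 0) := by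
      have := (h0.add (tendsto_finsetSum Finset.univ fun i _ => h1 i)).add h2
      simpa [traceDist] using this
    obtain ⟨n, hn⟩ := (h.eventually (gt_mem_nhds hε)).exists
    exact ⟨φ n, hφ n, hn⟩
  · intro h
    -- For `n = 0` the inverse is `∞`, which is harmless.
    have hpos : ∀ n : ℕ, (0 : ℝ≥0∞) < (n : ℝ≥0∞)⁻¹ := fun n => by simp
    choose φ hφ hlt using fun n : ℕ => h _ (hpos n)
    have hlim : Tendsto (fun n : ℕ => (n : ℝ≥0∞)⁻¹) atTop (𝓝 0) :=
      ENNReal.tendsto_inv_nat_nhds_zero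
    refine ⟨φ, hφ, ?_, fun i => ?_, ?_⟩
    · refine tendsto_of_tendsto_of_tendsto_of_le_of_le tendsto_const_nhds hlim
        (fun n => zero_le) fun n => ?_
      exact (le_self_add.trans le_self_add).trans (hlt n).le
    · refine tendsto_of_tendsto_of_tendsto_of_le_of_le tendsto_const_nhds hlim
        (fun n => zero_le) fun n => ?_
      refine le_trans ?_ (hlt n).le
      refine le_trans ?_ (le_self_add.trans_eq rfl)
      refine le_trans ?_ le_add_self
      exact Finset.single_le_sum (f := fun i => eLpNorm (fun x => pderiv i (φ n) x - H1.wd u i x) 2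
        (volume.restrict Ω)) (fun _ _ => zero_le) (Finset.mem_univ i)
    · refine tendsto_of_tendsto_of_tendsto_of_le_of_le tendsto_const_nhds hlim
        (fun n => zero_le) fun n => ?_
      exact le_add_self.trans (hlt n).le

lemma HasTrace.add {Ω : Set (E d)} {u v : H1 𝕜 Ω} {γ κ : L2Bd 𝕜 Ω} (hu : HasTrace u γ)
    (hv : HasTrace v κ) : HasTrace (u + v) (γ + κ) := by
  rw [hasTrace_iff] at hu hv ⊢
  intro ε hε
  obtain ⟨φ, hφ, h1⟩ := hu (ε / 2) (ENNReal.half_pos hε.ne')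
  obtain ⟨ψ, hψ, h2⟩ := hv (ε / 2) (ENNReal.half_pos hε.ne')
  refine ⟨fun x => φ x + ψ x, hφ.add hψ, ?_⟩
  have h3 := ENNReal.add_lt_add h1 h2
  rw [ENNReal.add_halves] at h3
  refine lt_of_le_of_lt ?_ h3
  have a0 := eLpNorm_add_sub_coeFn_add_le (μ := volume.restrict Ω)
    hφ.continuous.aestronglyMeasurable hψ.continuous.aestronglyMeasurable (H1.fn u) (H1.fn v)
  have a1 : ∀ i, eLpNorm (fun x => pderiv i (fun x => φ x + ψ x) x - H1.wd (u + v) i x) 2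
      (volume.restrict Ω) ≤ eLpNorm (fun x => pderiv i φ x - H1.wd u i x) 2 (volume.restrict Ω)
      + eLpNorm (fun x => pderiv i ψ x - H1.wd v i x) 2 (volume.restrict Ω) := fun i => by
    simp only [pderiv_add hφ hψ, H1.wd_add]
    exact eLpNorm_add_sub_coeFn_add_le (continuous_pderiv hφ i).aestronglyMeasurable
      (continuous_pderiv hψ i).aestronglyMeasurable _ _
  have a2 := eLpNorm_add_sub_coeFn_add_le (μ := surface Ω)
    hφ.continuous.aestronglyMeasurable hψ.continuous.aestronglyMeasurable γ κ
  unfold traceDist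
  refine (add_le_add (add_le_add a0 (Finset.sum_le_sum fun i _ => a1 i)) a2).trans_eq ?_
  rw [Finset.sum_add_distrib]
  abel

/-- Serves complexification, real and imaginary parts, conjugation and multiplication by scalars
alike. -/
lemma HasTrace.map (L : 𝕜 →L[ℝ] 𝕜') {Ω : Set (E d)} {u : H1 𝕜 Ω} {γ : L2Bd 𝕜 Ω}
    (h : HasTrace u γ) : HasTrace (H1.map L u) (L.compLp γ) := by
  rw [hasTrace_iff] at h ⊢
  intro ε hε
  -- The `+ 1` allows for `L = 0`.
  obtain ⟨φ, hφ, h1⟩ := h (ε / (‖L‖ₑ + 1))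
    (ENNReal.div_pos hε.ne' (by simp))
  refine ⟨fun x => L (φ x), L.contDiff.comp hφ, ?_⟩
  have h2 : traceDist (H1.map L u) (L.compLp γ) (fun x => L (φ x)) ≤ ‖L‖ₑ * traceDist u γ φ := by
    unfold traceDist
    simp only [pderiv_comp L hφ, H1.wd_map, H1.fn_map, mul_add, Finset.mul_sum]
    exact add_le_add (add_le_add (eLpNorm_comp_sub_compLp_le L _ _)
      (Finset.sum_le_sum fun i _ => eLpNorm_comp_sub_compLp_le L _ _))
      (eLpNorm_comp_sub_compLp_le L _ _)
  calc _ ≤ ‖L‖ₑ * traceDist u γ φ := h2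
    _ ≤ (‖L‖ₑ + 1) * traceDist u γ φ := by gcongr; exact le_self_add
    _ < ε := by
      rw [mul_comm]
      exact (ENNReal.lt_div_iff_mul_lt (Or.inl (by simp)) (Or.inl (by simp))).1 h1

/-- Multiplication by a scalar, as a real-linear map. -/
def scalarMul (c : 𝕜) : 𝕜 →L[ℝ] 𝕜 := c • ContinuousLinearMap.id ℝ 𝕜

lemma compLp_scalarMul {X : Type*} [MeasurableSpace X] {μ : Measure X} (c : 𝕜) (f : Lp 𝕜 2 μ) :
    (scalarMul c).compLp f = c • f := by
  refine Lp.ext ?_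
  filter_upwards [(scalarMul c).coeFn_compLp f, Lp.coeFn_smul c f] with x h1 h2
  rw [h1, h2]
  simp [scalarMul]

lemma HasTrace.smul (c : 𝕜) {Ω : Set (E d)} {u : H1 𝕜 Ω} {γ : L2Bd 𝕜 Ω}
    (h : HasTrace u γ) : HasTrace (c • u) (c • γ) := by
  have h1 := h.map (scalarMul c)
  rw [compLp_scalarMul] at h1
  convert h1 using 1
  refine Subtype.ext (PiLp.ext fun o => ?_)
  exact (compLp_scalarMul c (u.1 o)).symm

lemma HasTrace.sub {Ω : Set (E d)} {u v : H1 𝕜 Ω} {γ κ : L2Bd 𝕜 Ω} (hu : HasTrace u γ)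
    (hv : HasTrace v κ) : HasTrace (u - v) (γ - κ) := by
  have := hu.add (hv.smul (-1 : 𝕜))
  simpa [sub_eq_add_neg] using this

lemma hasTrace_zero (Ω : Set (E d)) : HasTrace (0 : H1 𝕜 Ω) (0 : L2Bd 𝕜 Ω) := by
  rw [hasTrace_iff]
  intro ε hε
  refine ⟨fun _ => 0, contDiff_const, ?_⟩
  have h : ∀ (μ : Measure (E d)), eLpNorm (fun x => (0 : 𝕜) - (0 : Lp 𝕜 2 μ) x) 2 μ = 0 := by
    intro μ
    rw [← eLpNorm_zero (ε := 𝕜) (p := 2) (μ := μ)]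
    refine eLpNorm_congr_ae ?_
    filter_upwards [Lp.coeFn_zero 𝕜 2 μ] with x hx
    rw [hx]
    simp
  have h1 : ∀ i x, pderiv i (fun _ : E d => (0 : 𝕜)) x = 0 := by
    intro i x
    simp [pderiv]
  have e : traceDist (0 : H1 𝕜 Ω) (0 : L2Bd 𝕜 Ω) (fun _ => 0) = 0 := by
    unfold traceDist
    simp only [h1]
    have e1 : H1.fn (0 : H1 𝕜 Ω) = 0 := rfl
    have e2 : ∀ i, H1.wd (0 : H1 𝕜 Ω) i = 0 := fun i => rfl
    simp only [e1, e2, h, Finset.sum_const_zero, add_zero]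
  rwa [e]

lemma traceDist_le {Ω : Set (E d)} (u v : H1 𝕜 Ω) (γ κ : L2Bd 𝕜 Ω) {φ : E d → 𝕜}
    (hφ : ContDiff ℝ ∞ φ) :
    traceDist v κ φ ≤ traceDist u γ φ + ((1 + d) * ‖u - v‖ₑ + ‖γ - κ‖ₑ) := by
  have a0 : eLpNorm (fun x => φ x - H1.fn v x) 2 (volume.restrict Ω) ≤
      eLpNorm (fun x => φ x - H1.fn u x) 2 (volume.restrict Ω) + ‖u - v‖ₑ := by
    refine (eLpNorm_sub_coeFn_le hφ.continuous.aestronglyMeasurable (H1.fn u) (H1.fn v)).trans ?_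
    gcongr
    exact enorm_le_iff_norm_le.2 (norm_fn_le (u - v))
  have a1 : ∀ i, eLpNorm (fun x => pderiv i φ x - H1.wd v i x) 2 (volume.restrict Ω) ≤
      eLpNorm (fun x => pderiv i φ x - H1.wd u i x) 2 (volume.restrict Ω) + ‖u - v‖ₑ := fun i => by
    refine (eLpNorm_sub_coeFn_le (continuous_pderiv hφ i).aestronglyMeasurable
      (H1.wd u i) (H1.wd v i)).trans ?_
    gcongr
    exact enorm_le_iff_norm_le.2 (norm_wd_le (u - v) i)
  have a2 := eLpNorm_sub_coeFn_le (μ := surface Ω) hφ.continuous.aestronglyMeasurable γ κ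
  unfold traceDist
  refine (add_le_add (add_le_add a0 (Finset.sum_le_sum fun i _ => a1 i)) a2).trans_eq ?_
  rw [Finset.sum_add_distrib]
  simp only [Finset.sum_const, Finset.card_univ, Fintype.card_fin, nsmul_eq_mul]
  ring

/-- The graph of the trace relation, as a subspace of `H¹(Ω) × L²(Γ)`. -/
def traceGraph (𝕜 : Type) [RCLike 𝕜] (Ω : Set (E d)) :
    Submodule 𝕜 (WithLp 2 (H1 𝕜 Ω × L2Bd 𝕜 Ω)) where
  carrier := {U | HasTrace U.fst U.snd}
  zero_mem' := hasTrace_zero Ω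
  add_mem' := fun hu hv => HasTrace.add hu hv
  smul_mem' := fun c _ hu => HasTrace.smul c hu

/-- By `traceDist_le`, a smooth approximant of a nearby pair in the graph also approximates the
limit pair. Closedness makes the graph a Hilbert space, on which Lax–Milgram applies. -/
lemma isClosed_traceGraph (Ω : Set (E d)) :
    IsClosed (traceGraph 𝕜 Ω : Set (WithLp 2 (H1 𝕜 Ω × L2Bd 𝕜 Ω))) := by
  refine isClosed_of_closure_subset fun V hV => ?_
  obtain ⟨U, hU, hlim⟩ := mem_closure_iff_seq_limit.1 hV
  change HasTrace V.fst V.snd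
  rw [hasTrace_iff]
  intro ε hε
  have h1 : Tendsto (fun n => (1 + d) * ‖(U n).fst - V.fst‖ₑ + ‖(U n).snd - V.snd‖ₑ) atTop
      (𝓝 0) := by
    have e1 : Tendsto (fun n => ‖(U n).fst - V.fst‖ₑ) atTop (𝓝 0) := by
      simpa only [edist_eq_enorm_sub] using! tendsto_iff_edist_tendsto_0.1
        (((WithLp.fstL 2 𝕜 (H1 𝕜 Ω) (L2Bd 𝕜 Ω)).continuous.tendsto V).comp hlim)
    have e2 : Tendsto (fun n => ‖(U n).snd - V.snd‖ₑ) atTop (𝓝 0) := by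
      simpa only [edist_eq_enorm_sub] using! tendsto_iff_edist_tendsto_0.1
        (((WithLp.sndL 2 𝕜 (H1 𝕜 Ω) (L2Bd 𝕜 Ω)).continuous.tendsto V).comp hlim)
    have := (ENNReal.Tendsto.const_mul (a := (1 + d : ℝ≥0∞)) e1 (Or.inr (by simp))).add e2
    simpa using this
  obtain ⟨n, hn⟩ := (h1.eventually (gt_mem_nhds (ENNReal.half_pos hε.ne'))).exists
  obtain ⟨φ, hφ, hlt⟩ := hasTrace_iff.1 (hU n) (ε / 2) (ENNReal.half_pos hε.ne')
  refine ⟨φ, hφ, (traceDist_le (U n).fst V.fst (U n).snd V.snd hφ).trans_lt ?_⟩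
  have h3 := ENNReal.add_lt_add hlt hn
  rwa [ENNReal.add_halves] at h3

/-- Integration against a real test function is the inner product with a fixed element of `L²`. -/
lemma continuous_integral_mul {G : Set (E d)} {φ : E d → ℝ} (hc : Continuous φ)
    (hs : HasCompactSupport φ) : Continuous fun u : L2 𝕜 G => ∫ x in G, (φ x : 𝕜) * u x := by
  have h1 : MemLp (fun x => (φ x : 𝕜)) 2 ((volume : Measure (E d)).restrict G) :=
    (hc.memLp_of_hasCompactSupport (μ := (volume : Measure (E d)).restrict G) (p := 2) hs).ofReal
  have h2 : (fun u : L2 𝕜 G => ∫ x in G, (φ x : 𝕜) * u x) = fun u => inner 𝕜 (h1.toLp _) u := by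
    funext u
    rw [L2.inner_def]
    refine integral_congr_ae ?_
    filter_upwards [h1.coeFn_toLp] with x hx
    rw [hx]
    simp [mul_comm]
  rw [h2]
  exact continuous_const.inner continuous_id

lemma isClosed_H1 (G : Set (E d)) :
    IsClosed (H1 𝕜 G : Set (PiLp 2 (fun _ : Option (Fin d) => L2 𝕜 G))) := by
  have h : (H1 𝕜 G : Set (PiLp 2 (fun _ : Option (Fin d) => L2 𝕜 G))) =
      ⋂ (φ : E d → ℝ) (_ : IsTest G φ) (i : Fin d), {U | ∫ x in G, ((pderiv i φ x : ℝ) : 𝕜) *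
        (U none : E d → 𝕜) x = -∫ x in G, ((φ x : ℝ) : 𝕜) * (U (some i) : E d → 𝕜) x} := by
    ext U
    simp only [mem_iInter]
    rfl
  rw [h]
  refine isClosed_iInter fun φ => isClosed_iInter fun hφ => isClosed_iInter fun i => ?_
  exact isClosed_eq
    ((continuous_integral_mul (hφ.pderiv_continuous i) (hφ.pderiv_compact i)).comp
      (PiLp.continuous_apply 2 _ none))
    ((continuous_integral_mul hφ.smooth.continuous hφ.compact).comp
      (PiLp.continuous_apply 2 _ (some i))).neg

instance completeSpace_H1 (G : Set (E d)) : CompleteSpace (H1 𝕜 G) :=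
  (isClosed_H1 G).completeSpace_coe

lemma inner_lp_eq {X : Type*} [MeasurableSpace X] {μ : Measure X} (f g : Lp 𝕜 2 μ) :
    inner 𝕜 f g = ∫ x, g x * conj (f x) ∂μ := by
  rw [L2.inner_def]
  simp

lemma H1.inner_eq {G : Set (E d)} (ψ u : H1 𝕜 G) :
    inner 𝕜 ψ u = ∫ x in G, ((∑ i, H1.wd u i x * conj (H1.wd ψ i x))
      + H1.fn u x * conj (H1.fn ψ x)) := by
  have hint : ∀ f g : L2 𝕜 G, Integrable (fun x => g x * conj (f x)) (volume.restrict G) := by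
    intro f g
    have := L2.integrable_inner (𝕜 := 𝕜) f g
    simpa using this
  rw [integral_add (integrable_finsetSum _ fun i _ => hint _ _) (hint _ _),
    integral_finsetSum _ fun i _ => hint _ _, Submodule.coe_inner, PiLp.inner_apply,
    Fintype.sum_option, add_comm]
  simp only [inner_lp_eq]
  rfl

end Maps

end

end InverseSource

/-! ### The complex Robin problem: solvability, stability and reciprocity. -/

namespace InverseSource

noncomputable section

variable {d : ℕ}

section LpComplex

variable {X : Type*} [MeasurableSpace X] {μ : Measure X}

/-- Complexification of a real-valued `L²` function. -/
def toComplex (f : Lp ℝ 2 μ) : Lp ℂ 2 μ := Complex.ofRealCLM.compLp f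

/-- The imaginary part of a complex-valued `L²` function. -/
def imLp (f : Lp ℂ 2 μ) : Lp ℝ 2 μ := Complex.imCLM.compLp f

/-- The complex conjugate of an `L²` function. -/
def conjLp (f : Lp ℂ 2 μ) : Lp ℂ 2 μ := Complex.conjCLE.toContinuousLinearMap.compLp f

lemma coeFn_toComplex (f : Lp ℝ 2 μ) : ∀ᵐ x ∂μ, toComplex f x = (f x : ℂ) :=
  Complex.ofRealCLM.coeFn_compLp f

lemma coeFn_imLp (f : Lp ℂ 2 μ) : ∀ᵐ x ∂μ, imLp f x = (f x).im :=
  Complex.imCLM.coeFn_compLp f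

lemma coeFn_conjLp (f : Lp ℂ 2 μ) : ∀ᵐ x ∂μ, conjLp f x = conj (f x) :=
  Complex.conjCLE.toContinuousLinearMap.coeFn_compLp f

lemma norm_toComplex_le (f : Lp ℝ 2 μ) : ‖toComplex f‖ ≤ ‖f‖ := by
  refine Lp.norm_le_norm_of_ae_le ?_
  filter_upwards [coeFn_toComplex f] with x hx
  rw [hx]
  simp

lemma norm_imLp_le (f : Lp ℂ 2 μ) : ‖imLp f‖ ≤ ‖f‖ := by
  refine Lp.norm_le_norm_of_ae_le ?_
  filter_upwards [coeFn_imLp f] with x hx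
  rw [hx]
  exact Complex.abs_im_le_norm _

lemma imLp_sub (f g : Lp ℂ 2 μ) : imLp (f - g) = imLp f - imLp g := by
  refine Lp.ext ?_
  filter_upwards [coeFn_imLp (f - g), coeFn_imLp f, coeFn_imLp g, Lp.coeFn_sub f g,
    Lp.coeFn_sub (imLp f) (imLp g)] with x h1 h2 h3 h4 h5
  rw [h1, h4, h5, Pi.sub_apply, Pi.sub_apply, h2, h3, Complex.sub_im]

lemma imLp_toComplex (f : Lp ℝ 2 μ) : imLp (toComplex f) = 0 := by
  refine Lp.ext ?_
  filter_upwards [coeFn_imLp (toComplex f), coeFn_toComplex f, Lp.coeFn_zero ℝ 2 μ] with x h1 h2 h3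
  rw [h1, h2, h3]
  simp

lemma integrable_mul_conj (f g : Lp ℂ 2 μ) : Integrable (fun x => g x * conj (f x)) μ := by
  have := L2.integrable_inner (𝕜 := ℂ) f g
  simpa using this

lemma integrable_ofReal_mul_conj {f : X → ℝ}
    (hf : MemLp f 2 μ) (a : Lp ℂ 2 μ) : Integrable (fun x => (f x : ℂ) * conj (a x)) μ := by
  refine (integrable_mul_conj a (toComplex (hf.toLp f))).congr ?_
  filter_upwards [coeFn_toComplex (hf.toLp f), hf.coeFn_toLp] with x h1 h2
  rw [h1, h2]

lemma inner_toComplex (a : Lp ℂ 2 μ) (f : Lp ℝ 2 μ) :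
    inner ℂ a (toComplex f) = ∫ x, (f x : ℂ) * conj (a x) ∂μ := by
  rw [inner_lp_eq]
  refine integral_congr_ae ?_
  filter_upwards [coeFn_toComplex f] with x hx
  rw [hx]

/-- Conjugating the first argument turns the inner product into the symmetric bilinear pairing `∫ a
b`. -/
lemma inner_conjLp_comm (a b : Lp ℂ 2 μ) : inner ℂ (conjLp a) b = inner ℂ (conjLp b) a := by
  rw [inner_lp_eq, inner_lp_eq]
  refine integral_congr_ae ?_
  filter_upwards [coeFn_conjLp a, coeFn_conjLp b] with x h1 h2
  rw [h1, h2]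
  simp [mul_comm]

lemma integral_ofReal_mul_conj {f : X → ℝ} {a : X → ℂ}
    (h : Integrable (fun x => (f x : ℂ) * conj (a x)) μ) :
    ∫ x, (f x : ℂ) * conj (a x) ∂μ =
      ((∫ x, f x * (a x).re ∂μ : ℝ) : ℂ) - Complex.I * ((∫ x, f x * (a x).im ∂μ : ℝ) : ℂ) := by
  have h1 := integral_re_add_im h
  rw [← h1]
  simp only [RCLike.re_to_complex, RCLike.im_to_complex, RCLike.I_to_complex, Complex.mul_re,
    Complex.mul_im, Complex.ofReal_re, Complex.ofReal_im, Complex.conj_re, Complex.conj_im,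
    zero_mul, neg_zero, sub_zero, add_zero, mul_neg, integral_neg, Complex.coe_algebraMap]
  push_cast
  ring

lemma im_inner_conjLp_toComplex (a : Lp ℂ 2 μ) (f : Lp ℝ 2 μ) :
    (inner ℂ (conjLp a) (toComplex f)).im = inner ℝ f (imLp a) := by
  rw [inner_toComplex, integral_ofReal_mul_conj, L2.inner_def]
  · simp only [Complex.sub_im, Complex.ofReal_im, Complex.mul_im, Complex.I_re, Complex.I_im,
      Complex.ofReal_re, zero_mul, one_mul, zero_add, zero_sub]
    rw [← integral_neg]
    refine integral_congr_ae ?_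
    filter_upwards [coeFn_conjLp a, coeFn_imLp a] with x h1 h2
    rw [h1, h2]
    simp [mul_comm]
  · exact integrable_ofReal_mul_conj (Lp.memLp f) _

lemma norm_toLp_le_of_bound [IsFiniteMeasure μ] {k : X → ℝ} (hk : MemLp k 2 μ) {δ : ℝ} (hδ : 0 ≤ δ)
    (h : ∀ᵐ x ∂μ, |k x| ≤ δ) : ‖hk.toLp k‖ ≤ √(μ.real univ) * δ := by
  have h1 := Lp.norm_le_of_ae_bound (f := hk.toLp k) (p := 2) hδ (by
    filter_upwards [hk.coeFn_toLp, h] with x h1 h2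
    rw [h1]
    exact h2)
  refine h1.trans_eq ?_
  rw [Real.sqrt_eq_rpow]
  congr 1
  norm_num [measureUnivNNReal, Measure.real, ENNReal.coe_toNNReal_eq_toReal]

end LpComplex

section Hilbert

/-- The Lax–Milgram theorem for a bounded operator on a complex Hilbert space. -/
lemma surjective_of_coercive {H : Type*} [NormedAddCommGroup H] [InnerProductSpace ℂ H]
    [CompleteSpace H] (T : H →L[ℂ] H) {c : NNReal} (h : ∀ x, ‖x‖ ^ 2 ≤ c * ‖inner ℂ x (T x)‖) :
    Function.Surjective T := by
  have hb : ∀ x, ‖x‖ ≤ c * ‖T x‖ := by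
    intro x
    rcases eq_or_ne x 0 with rfl | hx
    · simp
    have h1 := (h x).trans (mul_le_mul_of_nonneg_left (norm_inner_le_norm x (T x)) c.2)
    have h2 : 0 < ‖x‖ := norm_pos_iff.2 hx
    nlinarith
  have hcl : IsClosed (T.range : Set H) :=
    (ContinuousLinearMap.antilipschitz_of_bound T hb).isClosed_range T.uniformContinuous
  have : CompleteSpace T.range := hcl.completeSpace_coe
  have htop : T.range = ⊤ := by
    -- A vector `w` orthogonal to the range has `⟨w, T w⟩ = 0`, hence is zero by coercivity.
    rw [← Submodule.orthogonal_eq_bot_iff, Submodule.eq_bot_iff]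
    intro w hw
    have h1 : inner ℂ w (T w) = 0 :=
      (Submodule.mem_orthogonal' _ _).1 hw _ ⟨w, rfl⟩
    have h2 := h w
    rw [h1, norm_zero, mul_zero] at h2
    exact norm_eq_zero.1 (pow_eq_zero_iff two_ne_zero |>.1 (le_antisymm h2 (sq_nonneg _)))
  exact LinearMap.range_eq_top.1 htop

/-- Solvability of the variational problem `⟨y₁, x₁⟩ + i ⟨y₂, x₂⟩ = ℓ(y)` on a closed subspace of a
product of Hilbert spaces. -/
lemma exists_weak_solution {H₁ H₂ H₃ : Type*} [NormedAddCommGroup H₁] [InnerProductSpace ℂ H₁]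
    [CompleteSpace H₁] [NormedAddCommGroup H₂] [InnerProductSpace ℂ H₂] [CompleteSpace H₂]
    [NormedAddCommGroup H₃] [InnerProductSpace ℂ H₃] [CompleteSpace H₃]
    (W : Submodule ℂ (WithLp 2 (H₁ × H₂))) (hW : IsClosed (W : Set (WithLp 2 (H₁ × H₂))))
    (J : H₁ →L[ℂ] H₃) (f : H₃) (g : H₂) :
    ∃ x ∈ W, ∀ y ∈ W, inner ℂ y.fst x.fst + Complex.I * inner ℂ y.snd x.snd =
      inner ℂ (J y.fst) f + inner ℂ y.snd g := by
  have : CompleteSpace W := hW.completeSpace_coe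
  let A : W →L[ℂ] H₁ := (WithLp.fstL 2 ℂ H₁ H₂).comp W.subtypeL
  let B : W →L[ℂ] H₂ := (WithLp.sndL 2 ℂ H₁ H₂).comp W.subtypeL
  -- The operator representing the sesquilinear form on `W`.
  let T : W →L[ℂ] W := A.adjoint.comp A + B.adjoint.comp (Complex.I • B)
  have hT : ∀ x y, inner ℂ x (T y) = inner ℂ (A x) (A y) + Complex.I * inner ℂ (B x) (B y) := by
    intro x y
    change inner ℂ x (A.adjoint (A y) + B.adjoint (Complex.I • B y)) = _
    rw [inner_add_right, ContinuousLinearMap.adjoint_inner_right,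
      ContinuousLinearMap.adjoint_inner_right, inner_smul_right]
  have hn : ∀ x : W, ‖x‖ ^ 2 = ‖A x‖ ^ 2 + ‖B x‖ ^ 2 := fun x =>
    WithLp.prod_norm_sq_eq_of_L2 (x : WithLp 2 (H₁ × H₂))
  have hs : Function.Surjective T := by
    refine surjective_of_coercive T (c := 2) fun x => ?_
    rw [hn, hT]
    -- Real and imaginary part of the form are the two parts of `‖x‖²`, and each is at most `‖z‖`;
    -- hence the constant 2.
    set z := inner ℂ (A x) (A x) + Complex.I * inner ℂ (B x) (B x) with hz
    rw [inner_self_eq_norm_sq_to_K (A x), inner_self_eq_norm_sq_to_K (B x)] at hz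
    have h1 : z.re = ‖A x‖ ^ 2 := by rw [hz]; simp [← Complex.ofReal_pow]
    have h2 : z.im = ‖B x‖ ^ 2 := by rw [hz]; simp [← Complex.ofReal_pow]
    have h3 := Complex.re_le_norm z
    have h4 := (le_abs_self _).trans (Complex.abs_im_le_norm z)
    push_cast
    linarith
  obtain ⟨x, hx⟩ := hs (A.adjoint (J.adjoint f) + B.adjoint g)
  refine ⟨x, x.2, fun y hy => ?_⟩
  have e := hT ⟨y, hy⟩ x
  rw [hx, inner_add_right, ContinuousLinearMap.adjoint_inner_right,
    ContinuousLinearMap.adjoint_inner_right, ContinuousLinearMap.adjoint_inner_right] at e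
  exact e.symm

end Hilbert

section Robin

variable {Ω : Set (E d)}

/-- The imaginary part of a complex-valued Sobolev function, in `L²`. -/
def imPart (u : H1 ℂ Ω) : L2 ℝ Ω := imLp (H1.fn u)

lemma imPart_sub (u v : H1 ℂ Ω) : imPart (u - v) = imPart u - imPart v := imLp_sub _ _

lemma norm_imPart_le (u : H1 ℂ Ω) : ‖imPart u‖ ≤ ‖u‖ := (norm_imLp_le _).trans (norm_fn_le u)

lemma imNorm_eq (u : H1 ℂ Ω) : imNorm u = ‖imPart u‖ := by
  have h : ‖imPart u‖ ^ 2 = ∫ x in Ω, (H1.fn u x).im ^ 2 := by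
    rw [← real_inner_self_eq_norm_sq, L2.inner_def]
    refine integral_congr_ae ?_
    filter_upwards [coeFn_imLp (H1.fn u)] with x hx
    simp only [imPart, hx, RCLike.inner_apply, conj_trivial, sq]
  rw [imNorm, ← h, Real.sqrt_sq (norm_nonneg _)]

lemma isRobinSolution_iff {F h₁ h₂ : E d → ℝ} {u : H1 ℂ Ω} :
    IsRobinSolution Ω F h₁ h₂ u ↔ ∃ γ : L2Bd ℂ Ω, HasTrace u γ ∧
      ∀ (ψ : H1 ℂ Ω) (κ : L2Bd ℂ Ω), HasTrace ψ κ →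
        inner ℂ ψ u + Complex.I * inner ℂ κ γ =
          (∫ x in Ω, (F x : ℂ) * conj (H1.fn ψ x))
          + (∫ s, (h₂ s : ℂ) * conj (κ s) ∂(surface Ω))
          + Complex.I * ∫ s, (h₁ s : ℂ) * conj (κ s) ∂(surface Ω) := by
  simp only [H1.inner_eq, inner_lp_eq]
  rfl

lemma isRobinSolution_zero_iff {f : L2 ℝ Ω} {u : H1 ℂ Ω} :
    IsRobinSolution Ω f 0 0 u ↔ ∃ γ : L2Bd ℂ Ω, HasTrace u γ ∧
      ∀ (ψ : H1 ℂ Ω) (κ : L2Bd ℂ Ω), HasTrace ψ κ →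
        inner ℂ ψ u + Complex.I * inner ℂ κ γ = inner ℂ (H1.fn ψ) (toComplex f) := by
  rw [isRobinSolution_iff]
  simp [inner_toComplex]

lemma IsRobinSolution.congr {F F' h₁ h₂ : E d → ℝ} {u : H1 ℂ Ω}
    (h : IsRobinSolution Ω F h₁ h₂ u) (hF : F =ᵐ[volume.restrict Ω] F') :
    IsRobinSolution Ω F' h₁ h₂ u := by
  obtain ⟨γ, hγ, h⟩ := h
  refine ⟨γ, hγ, fun ψ κ hψ => (h ψ κ hψ).trans ?_⟩
  congr 2
  refine integral_congr_ae ?_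
  filter_upwards [hF] with x hx
  rw [hx]

lemma IsRobinSolution.sub {f f' : L2 ℝ Ω} {h₁ h₂ : E d → ℝ} {u u' : H1 ℂ Ω}
    (h : IsRobinSolution Ω f h₁ h₂ u) (h' : IsRobinSolution Ω f' h₁ h₂ u') :
    IsRobinSolution Ω (f - f' : L2 ℝ Ω) 0 0 (u - u') := by
  rw [isRobinSolution_iff] at h h'
  obtain ⟨γ, hγ, h⟩ := h
  obtain ⟨γ', hγ', h'⟩ := h'
  rw [isRobinSolution_iff]
  refine ⟨γ - γ', hγ.sub hγ', fun ψ κ hψ => ?_⟩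
  have e : ∫ x in Ω, (((f - f' : L2 ℝ Ω) : E d → ℝ) x : ℂ) * conj (H1.fn ψ x) =
      (∫ x in Ω, ((f : E d → ℝ) x : ℂ) * conj (H1.fn ψ x))
        - ∫ x in Ω, ((f' : E d → ℝ) x : ℂ) * conj (H1.fn ψ x) := by
    rw [← integral_sub (integrable_ofReal_mul_conj (Lp.memLp f) _)
      (integrable_ofReal_mul_conj (Lp.memLp f') _)]
    refine integral_congr_ae ?_
    filter_upwards [Lp.coeFn_sub f f'] with x hx
    rw [hx, Pi.sub_apply]
    push_cast
    ring
  have e1 := h ψ κ hψ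
  have e2 := h' ψ κ hψ
  rw [e, inner_sub_right, inner_sub_right]
  simp only [Pi.zero_apply, Complex.ofReal_zero, zero_mul, integral_zero, mul_zero, add_zero]
  linear_combination e1 - e2

/-- Test with `u` itself: the boundary term is purely imaginary and disappears from the real part.
-/
lemma IsRobinSolution.norm_le {f : L2 ℝ Ω} {u : H1 ℂ Ω} (h : IsRobinSolution Ω f 0 0 u) :
    ‖u‖ ≤ ‖f‖ := by
  obtain ⟨γ, hγ, h⟩ := isRobinSolution_zero_iff.1 h
  have e := congrArg Complex.re (h u γ hγ)
  rw [inner_self_eq_norm_sq_to_K u, inner_self_eq_norm_sq_to_K γ] at e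
  have e1 : ‖u‖ ^ 2 = (inner ℂ (H1.fn u) (toComplex f)).re := by
    rw [← e]
    simp [← Complex.ofReal_pow]
  have e2 : ‖u‖ ^ 2 ≤ ‖u‖ * ‖f‖ := by
    rw [e1]
    refine (Complex.re_le_norm _).trans ((norm_inner_le_norm _ _).trans ?_)
    exact mul_le_mul (norm_fn_le u) (norm_toComplex_le f) (norm_nonneg _) (norm_nonneg _)
  rcases (norm_nonneg u).eq_or_lt with h0 | h0
  · rw [← h0]
    exact norm_nonneg _
  · nlinarith

/-- Complex conjugation on `H¹(Ω; ℂ)`. -/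
def conjH1 (u : H1 ℂ Ω) : H1 ℂ Ω := H1.map Complex.conjCLE.toContinuousLinearMap u

lemma inner_conjH1_comm (u v : H1 ℂ Ω) : inner ℂ (conjH1 u) v = inner ℂ (conjH1 v) u := by
  rw [Submodule.coe_inner, Submodule.coe_inner, PiLp.inner_apply, PiLp.inner_apply]
  exact Finset.sum_congr rfl fun o _ => inner_conjLp_comm _ _

/-- Reciprocity: the Robin problem is symmetric for the bilinear pairing. -/
lemma IsRobinSolution.inner_imPart_comm {f g : L2 ℝ Ω} {u w : H1 ℂ Ω}
    (hu : IsRobinSolution Ω f 0 0 u) (hw : IsRobinSolution Ω g 0 0 w) :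
    inner ℝ f (imPart w) = inner ℝ g (imPart u) := by
  obtain ⟨γ, hγ, hu⟩ := isRobinSolution_zero_iff.1 hu
  obtain ⟨κ, hκ, hw⟩ := isRobinSolution_zero_iff.1 hw
  -- Tested with the conjugate of the other solution, both left-hand sides become the same symmetric
  -- bilinear expression. Hence `∫ f w = ∫ g u`, and since `f` and `g` are real the imaginary parts
  -- give the claim.
  have e1 := hu (conjH1 w) (conjLp κ) (hκ.map _)
  have e2 := hw (conjH1 u) (conjLp γ) (hγ.map _)
  rw [inner_conjH1_comm, inner_conjLp_comm, e2] at e1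
  have e3 := congrArg Complex.im e1
  have c1 : (inner ℂ (H1.fn (conjH1 u)) (toComplex g)).im = inner ℝ g (imPart u) :=
    im_inner_conjLp_toComplex (H1.fn u) g
  have c2 : (inner ℂ (H1.fn (conjH1 w)) (toComplex f)).im = inner ℝ f (imPart w) :=
    im_inner_conjLp_toComplex (H1.fn w) f
  rw [← c1, ← c2, e3]

/-- The Robin problem is solvable for square integrable data. -/
lemma exists_isRobinSolution (Ω : Set (E d)) (f : L2 ℝ Ω) {h₁ h₂ : E d → ℝ}
    (hh₁ : MemLp h₁ 2 (surface Ω)) (hh₂ : MemLp h₂ 2 (surface Ω)) :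
    ∃ u : H1 ℂ Ω, IsRobinSolution Ω f h₁ h₂ u := by
  obtain ⟨x, hx, h⟩ := exists_weak_solution (traceGraph ℂ Ω) (isClosed_traceGraph Ω)
    ((PiLp.proj 2 (fun _ : Option (Fin d) => L2 ℂ Ω) none).comp (H1 ℂ Ω).subtypeL)
    (toComplex f) (toComplex (hh₂.toLp h₂) + Complex.I • toComplex (hh₁.toLp h₁))
  refine ⟨x.fst, isRobinSolution_iff.2 ⟨x.snd, hx, fun ψ κ hψ => ?_⟩⟩
  have e := h (WithLp.toLp 2 (ψ, κ)) hψ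
  rw [inner_add_right, inner_smul_right, inner_toComplex, inner_toComplex, inner_toComplex] at e
  have c1 : ∫ s, (h₁ s : ℂ) * conj (κ s) ∂(surface Ω) =
      ∫ s, (hh₁.toLp h₁ s : ℂ) * conj (κ s) ∂(surface Ω) := by
    refine integral_congr_ae ?_
    filter_upwards [hh₁.coeFn_toLp] with s hs
    rw [hs]
  have c2 : ∫ s, (h₂ s : ℂ) * conj (κ s) ∂(surface Ω) =
      ∫ s, (hh₂.toLp h₂ s : ℂ) * conj (κ s) ∂(surface Ω) := by
    refine integral_congr_ae ?_
    filter_upwards [hh₂.coeFn_toLp] with s hs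
    rw [hs]
  rw [c1, c2, add_assoc]
  exact e

end Robin

end

end InverseSource

/-! ### Extension by zero, the data error constant and the roots. -/

namespace InverseSource

noncomputable section

variable {d : ℕ} {Ω Ω₀ : Set (E d)}

section Extension

lemma memLp_extend (h₀ : IsOpen Ω₀) (hsub : Ω₀ ⊆ Ω) (p : L2 ℝ Ω₀) :
    MemLp (extend Ω₀ p) 2 (volume.restrict Ω) := by
  rw [extend, memLp_indicator_iff_restrict h₀.measurableSet,
    Measure.restrict_restrict_of_subset hsub]
  exact Lp.memLp p

/-- The extension by zero as an element of `L²(Ω)`. -/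
def extendLp (h₀ : IsOpen Ω₀) (hsub : Ω₀ ⊆ Ω) (p : L2 ℝ Ω₀) : L2 ℝ Ω :=
  (memLp_extend h₀ hsub p).toLp _

lemma coeFn_extendLp (h₀ : IsOpen Ω₀) (hsub : Ω₀ ⊆ Ω) (p : L2 ℝ Ω₀) :
    extendLp h₀ hsub p =ᵐ[volume.restrict Ω] extend Ω₀ p := MemLp.coeFn_toLp _

lemma extend_sub_ae (h₀ : IsOpen Ω₀) (p p' : L2 ℝ Ω₀) :
    extend Ω₀ (p - p') =ᵐ[volume.restrict Ω] fun x => extend Ω₀ p x - extend Ω₀ p' x := by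
  have h := Lp.coeFn_sub p p'
  rw [Filter.EventuallyEq, ae_restrict_iff' h₀.measurableSet] at h
  refine ae_restrict_of_ae ?_
  filter_upwards [h] with x hx
  by_cases hm : x ∈ Ω₀
  · simp only [extend, indicator_of_mem hm, hx hm, Pi.sub_apply]
  · simp only [extend, indicator_of_notMem hm, sub_zero]

lemma extendLp_sub (h₀ : IsOpen Ω₀) (hsub : Ω₀ ⊆ Ω) (p p' : L2 ℝ Ω₀) :
    extendLp h₀ hsub p - extendLp h₀ hsub p' = extendLp h₀ hsub (p - p') := by
  refine Lp.ext ?_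
  filter_upwards [Lp.coeFn_sub (extendLp h₀ hsub p) (extendLp h₀ hsub p'),
    coeFn_extendLp h₀ hsub p, coeFn_extendLp h₀ hsub p', coeFn_extendLp h₀ hsub (p - p'),
    extend_sub_ae (Ω := Ω) h₀ p p'] with x h1 h2 h3 h4 h5
  rw [h1, Pi.sub_apply, h2, h3, h4, h5]

lemma norm_extendLp (h₀ : IsOpen Ω₀) (hsub : Ω₀ ⊆ Ω) (p : L2 ℝ Ω₀) :
    ‖extendLp h₀ hsub p‖ = ‖p‖ := by
  rw [extendLp, Lp.norm_toLp, Lp.norm_def, extend,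
    eLpNorm_indicator_eq_eLpNorm_restrict h₀.measurableSet,
    Measure.restrict_restrict_of_subset hsub]

lemma inner_extendLp (h₀ : IsOpen Ω₀) (hsub : Ω₀ ⊆ Ω) (p : L2 ℝ Ω₀) (w : H1 ℂ Ω) :
    inner ℝ (extendLp h₀ hsub p) (imPart w) = ∫ x in Ω₀, (H1.fn w x).im * p x := by
  rw [L2.inner_def]
  have h1 : ∫ x in Ω, inner ℝ (extendLp h₀ hsub p x) (imPart w x) =
      ∫ x in Ω, Ω₀.indicator (fun x => (H1.fn w x).im * p x) x := by
    refine integral_congr_ae ?_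
    filter_upwards [coeFn_extendLp h₀ hsub p, coeFn_imLp (H1.fn w)] with x h1 h2
    rw [h1]
    simp only [imPart, h2, extend]
    by_cases hm : x ∈ Ω₀ <;> simp [hm]
  rw [h1, integral_indicator h₀.measurableSet, Measure.restrict_restrict_of_subset hsub]

end Extension

section DataError

/-- The complexification of a real-valued Sobolev function. -/
def complexify (v : H1 ℝ Ω) : H1 ℂ Ω := H1.map Complex.ofRealCLM v

lemma inner_toComplex_eq {X : Type*} [MeasurableSpace X] {μ : Measure X} (a : Lp ℂ 2 μ)
    (f : Lp ℝ 2 μ) : inner ℂ a (toComplex f) =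
      ((inner ℝ (Complex.reCLM.compLp a : Lp ℝ 2 μ) f : ℝ) : ℂ)
        - Complex.I * ((inner ℝ (Complex.imCLM.compLp a : Lp ℝ 2 μ) f : ℝ) : ℂ) := by
  have h : ∀ L : ℂ →L[ℝ] ℝ,
      inner ℝ (L.compLp a : Lp ℝ 2 μ) f = ∫ x, f x * L (a x) ∂μ := by
    intro L
    rw [L2.inner_def]
    refine integral_congr_ae ?_
    filter_upwards [L.coeFn_compLp a] with x hx
    rw [hx]
    simp
  rw [inner_toComplex, integral_ofReal_mul_conj (integrable_ofReal_mul_conj (Lp.memLp f) a), h, h]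
  simp only [Complex.reCLM_apply, Complex.imCLM_apply]

lemma inner_complexify (ψ : H1 ℂ Ω) (v : H1 ℝ Ω) : inner ℂ ψ (complexify v) =
    ((inner ℝ (H1.map Complex.reCLM ψ) v : ℝ) : ℂ)
      - Complex.I * ((inner ℝ (H1.map Complex.imCLM ψ) v : ℝ) : ℂ) := by
  simp only [Submodule.coe_inner, PiLp.inner_apply]
  push_cast
  rw [Finset.mul_sum, ← Finset.sum_sub_distrib]
  exact Finset.sum_congr rfl fun o _ => inner_toComplex_eq _ _

/-- An exact solution satisfies the weak equation also for complex-valued test functions. -/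
lemma IsExactSolution.exists_complex {g₁ g₂ : E d → ℝ} (h₀ : IsOpen Ω₀) (hsub : Ω₀ ⊆ Ω)
    (hg₂ : MemLp g₂ 2 (surface Ω)) {p : L2 ℝ Ω₀} {v : H1 ℝ Ω}
    (h : IsExactSolution Ω Ω₀ g₁ g₂ p v) :
    ∃ γ : L2Bd ℝ Ω, HasTrace (complexify v) (toComplex γ) ∧ γ =ᵐ[surface Ω] g₁ ∧
      ∀ (ψ : H1 ℂ Ω) (κ : L2Bd ℂ Ω), HasTrace ψ κ → inner ℂ ψ (complexify v) =
        (∫ x in Ω, (extend Ω₀ p x : ℂ) * conj (H1.fn ψ x))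
          + ∫ s, (g₂ s : ℂ) * conj (κ s) ∂(surface Ω) := by
  obtain ⟨γ, hγ, hγ₁, h⟩ := h
  refine ⟨γ, hγ.map Complex.ofRealCLM, hγ₁, fun ψ κ hψ => ?_⟩
  have hreal : ∀ (L : ℂ →L[ℝ] ℝ), inner ℝ (H1.map L ψ) v =
      (∫ x in Ω, extend Ω₀ p x * L (H1.fn ψ x)) + ∫ s, g₂ s * L (κ s) ∂(surface Ω) := by
    intro L
    have e := h (H1.map L ψ) (L.compLp κ) (hψ.map L)
    rw [H1.inner_eq]
    simp only [conj_trivial]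
    rw [e]
    congr 1
    · refine integral_congr_ae ?_
      filter_upwards [L.coeFn_compLp (H1.fn ψ)] with x hx
      rw [H1.fn_map, hx]
    · refine integral_congr_ae ?_
      filter_upwards [L.coeFn_compLp κ] with x hx
      rw [hx]
  rw [inner_complexify, hreal, hreal,
    integral_ofReal_mul_conj (integrable_ofReal_mul_conj (memLp_extend h₀ hsub p) (H1.fn ψ)),
    integral_ofReal_mul_conj (integrable_ofReal_mul_conj hg₂ κ)]
  simp only [Complex.reCLM_apply, Complex.imCLM_apply]
  push_cast
  ring

/-- The second bound gives `b ≤ c`, and then the first gives `a² ≤ c²`. -/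
lemma le_of_sq_le_mul {a b c : ℝ} (hb : 0 ≤ b)
    (h₁ : a ^ 2 ≤ b * c) (h₂ : b ^ 2 ≤ b * c) (hc : 0 ≤ c) : a ≤ c := by
  have h3 : b ≤ c := by
    rcases hb.eq_or_lt with rfl | hb
    · exact hc
    · nlinarith
  exact le_of_sq_le_sq (by nlinarith) hc

lemma IsSmoothBoundedDomain.isFiniteMeasure_surface (hd : 1 ≤ d) (hΩ : IsSmoothBoundedDomain Ω) :
    IsFiniteMeasure (surface Ω) := ⟨hΩ.surface_univ_lt_top hd⟩

/-- The exact `v` satisfies the Robin condition with exact data, so `e = u - v` solves a Robin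
problem without source whose boundary data are the noise. Testing with `e` bounds `‖e‖` by the
noise, and `e` has the imaginary part of `u` because `v` is real. -/
theorem exists_isDataErrorConstant [IsFiniteMeasure (surface Ω)] :
    ∃ C₀ : ℝ, IsDataErrorConstant Ω C₀ := by
  set m := √((surface Ω).real univ) with hm
  -- The estimate below gives `2 m`; the `+ 1` ensures positivity.
  refine ⟨2 * m + 1, by positivity, ?_⟩
  intro Ω₀ h₀ hsub δ g₁ g₂ g₁' g₂' hdata p v hex u hu
  have hg₁ : MemLp g₁ 2 (surface Ω) := hdata.mem₁.mono_exponent le_top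
  have hg₂ : MemLp g₂ 2 (surface Ω) := hdata.mem₂.mono_exponent le_top
  have hg₁' : MemLp g₁' 2 (surface Ω) := hdata.mem₁'.mono_exponent le_top
  have hg₂' : MemLp g₂' 2 (surface Ω) := hdata.mem₂'.mono_exponent le_top
  obtain ⟨κ, hκ, hκ₁, hv⟩ := hex.exists_complex h₀ hsub hg₂
  obtain ⟨γ, hγ, hu⟩ := isRobinSolution_iff.1 hu
  set k₁ := (hg₁'.sub hg₁).toLp _ with hk₁
  set k₂ := (hg₂'.sub hg₂).toLp _ with hk₂
  have n₁ : ‖k₁‖ ≤ m * δ := norm_toLp_le_of_bound _ hdata.pos.le hdata.noise₁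
  have n₂ : ‖k₂‖ ≤ m * δ := norm_toLp_le_of_bound _ hdata.pos.le hdata.noise₂
  set e := u - complexify v with he
  set ζ := γ - toComplex κ with hζ
  have hsplit : ∀ {g g' : E d → ℝ} (hg : MemLp g 2 (surface Ω)) (hg' : MemLp g' 2 (surface Ω)),
      inner ℂ ζ (toComplex ((hg'.sub hg).toLp _)) =
        (∫ s, (g' s : ℂ) * conj (ζ s) ∂(surface Ω)) - ∫ s, (g s : ℂ) * conj (ζ s) ∂(surface Ω) := by
    intro g g' hg hg'
    rw [inner_toComplex, ← integral_sub (integrable_ofReal_mul_conj hg' ζ)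
      (integrable_ofReal_mul_conj hg ζ)]
    refine integral_congr_ae ?_
    filter_upwards [(hg'.sub hg).coeFn_toLp] with s hs
    rw [hs, Pi.sub_apply]
    push_cast
    ring
  have hκi : inner ℂ ζ (toComplex κ) = ∫ s, (g₁ s : ℂ) * conj (ζ s) ∂(surface Ω) := by
    rw [inner_toComplex]
    refine integral_congr_ae ?_
    filter_upwards [hκ₁] with s hs
    rw [hs]
  have key : inner ℂ e e + Complex.I * inner ℂ ζ ζ =
      inner ℂ ζ (toComplex k₂) + Complex.I * inner ℂ ζ (toComplex k₁) := by
    have e1 := hu e ζ (hγ.sub hκ)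
    have e2 := hv e ζ (hγ.sub hκ)
    have e3 : inner ℂ e e = inner ℂ e u - inner ℂ e (complexify v) := inner_sub_right _ _ _
    have e4 : inner ℂ ζ ζ = inner ℂ ζ γ - inner ℂ ζ (toComplex κ) := inner_sub_right _ _ _
    rw [e3, e4, hk₁, hk₂, hsplit hg₂ hg₂', hsplit hg₁ hg₁', hκi]
    linear_combination e1 - e2
  set z := inner ℂ e e + Complex.I * inner ℂ ζ ζ with hz
  have hzn : ‖z‖ ≤ ‖ζ‖ * (2 * m * δ) := by
    rw [key]
    calc _ ≤ ‖inner ℂ ζ (toComplex k₂)‖ + ‖Complex.I * inner ℂ ζ (toComplex k₁)‖ :=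
          norm_add_le _ _
      _ ≤ ‖ζ‖ * ‖k₂‖ + ‖ζ‖ * ‖k₁‖ := by
          rw [norm_mul, Complex.norm_I, one_mul]
          refine add_le_add ?_ ?_
          · exact (norm_inner_le_norm _ _).trans
              (mul_le_mul_of_nonneg_left (norm_toComplex_le _) (norm_nonneg _))
          · exact (norm_inner_le_norm _ _).trans
              (mul_le_mul_of_nonneg_left (norm_toComplex_le _) (norm_nonneg _))
      _ ≤ ‖ζ‖ * (m * δ) + ‖ζ‖ * (m * δ) := by gcongr
      _ = _ := by ring
  rw [inner_self_eq_norm_sq_to_K e, inner_self_eq_norm_sq_to_K ζ] at hz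
  have z1 : z.re = ‖e‖ ^ 2 := by rw [hz]; simp [← Complex.ofReal_pow]
  have z2 : z.im = ‖ζ‖ ^ 2 := by rw [hz]; simp [← Complex.ofReal_pow]
  have hδ := hdata.pos
  have hle : ‖e‖ ≤ 2 * m * δ := le_of_sq_le_mul (norm_nonneg ζ)
    (z1 ▸ (Complex.re_le_norm z).trans hzn)
    (z2 ▸ ((le_abs_self _).trans (Complex.abs_im_le_norm z)).trans hzn) (by positivity)
  have him : imPart e = imPart u := by
    have : imPart (complexify v) = 0 := imLp_toComplex (H1.fn v)
    rw [he, imPart_sub, this, sub_zero]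
  rw [imNorm_eq, ← him]
  refine (norm_imPart_le e).trans (hle.trans ?_)
  nlinarith

end DataError

section Flow

variable {P : Type} [NormedAddCommGroup P] [InnerProductSpace ℝ P]

/-- Differences of states solve the Robin problem with zero boundary data. Stability therefore gives
the Lipschitz bound with constant `‖J‖`, and reciprocity with the adjoint state `w t` gives the
gradient identity. -/
lemma IsDynamicSolution.exists_isDampedFlow (h₀ : IsOpen Ω₀) (hsub : Ω₀ ⊆ Ω)
    {J : P →L[ℝ] L2 ℝ Ω₀} {t₀ : ℝ} {η : ℝ → ℝ} {g₁ g₂ : E d → ℝ} {p₀ p₁ : P} {p q : ℝ → P}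
    {u w : ℝ → H1 ℂ Ω} (h : IsDynamicSolution Ω Ω₀ J t₀ η g₁ g₂ p₀ p₁ p q u w) {pd : P}
    {ud : H1 ℂ Ω} (hud : IsRobinSolution Ω (extend Ω₀ (J pd)) g₁ g₂ ud) :
    ∃ a, IsDampedFlow t₀ η p q a (fun t => imPart (u t)) pd (imPart ud) := by
  choose! a ha hev using h.evolution
  have hstate : ∀ {z : P} {v : H1 ℂ Ω}, IsRobinSolution Ω (extend Ω₀ (J z)) g₁ g₂ v →
      IsRobinSolution Ω (extendLp h₀ hsub (J z)) g₁ g₂ v :=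
    fun hv => hv.congr (coeFn_extendLp h₀ hsub _).symm
  have hdiff : ∀ {z z' : P} {v v' : H1 ℂ Ω}, IsRobinSolution Ω (extend Ω₀ (J z)) g₁ g₂ v →
      IsRobinSolution Ω (extend Ω₀ (J z')) g₁ g₂ v' →
      IsRobinSolution Ω (extendLp h₀ hsub (J (z - z'))) 0 0 (v - v') := by
    intro z z' v v' hv hv'
    rw [map_sub, ← extendLp_sub]
    exact (hstate hv).sub (hstate hv')
  have hgrad : ∀ t, t₀ < t → ∀ {z : P} {v : H1 ℂ Ω}, IsRobinSolution Ω (extend Ω₀ (J z)) g₁ g₂ v →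
      inner ℝ (imPart (u t)) (imPart v - imPart (u t)) =
        -inner ℝ (a t + η t • q t) (z - p t) := by
    intro t ht z v hv
    have hw : IsRobinSolution Ω (imPart (u t)) 0 0 (w t) := by
      refine (h.adjoint t ht.le).congr ?_
      filter_upwards [coeFn_imLp (H1.fn (u t))] with x hx using hx.symm
    have e1 := (hdiff hv (h.state t ht.le)).inner_imPart_comm hw
    have e2 := hev t ht (z - p t)
    rw [inner_extendLp] at e1
    rw [← imPart_sub, ← e1]
    linarith
  refine ⟨a, h.continuousOn_pos, h.continuousOn_vel, h.hasDerivAt_pos, ha, ⟨‖J‖, ?_⟩, ?_, ?_⟩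
  · intro s hs t ht
    have e := (hdiff (h.state s hs) (h.state t ht)).norm_le
    rw [norm_extendLp] at e
    rw [← imPart_sub]
    exact ((norm_imPart_le _).trans e).trans (J.le_opNorm _)
  · intro t ht s hs
    exact hgrad t ht (h.state s hs)
  · intro t ht
    exact hgrad t ht hud

/-- Existence of a root of the discrepancy function, and unique existence of a root of the total
energy discrepancy function, for an arbitrary Hilbert space of sources. -/
theorem IsDynamicSolution.roots [IsFiniteMeasure (surface Ω)] {C₀ : ℝ}
    (hC₀ : IsDataErrorConstant Ω C₀) (h₀ : IsOpen Ω₀) (hsub : Ω₀ ⊆ Ω)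
    {δ : ℝ} {g₁ g₂ g₁' g₂' : E d → ℝ} (hdata : IsNoisyData Ω δ g₁ g₂ g₁' g₂') {τ : ℝ} (hτ : 1 < τ)
    {t₀ : ℝ} {η : ℝ → ℝ} (hη : IsDamping t₀ η) {J : P →L[ℝ] L2 ℝ Ω₀}
    (hex : ∃ (pd : P) (v : H1 ℝ Ω), IsExactSolution Ω Ω₀ g₁ g₂ (J pd) v)
    {p₀ p₁ : P} {p q : ℝ → P} {u w : ℝ → H1 ℂ Ω}
    (h : IsDynamicSolution Ω Ω₀ J t₀ η g₁' g₂' p₀ p₁ p q u w) :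
    (C₀ * τ * δ ≤ imNorm (u t₀) → ∃ T, t₀ ≤ T ∧ morozov C₀ τ δ u T = 0) ∧
      (C₀ ^ 2 * τ ^ 2 * δ ^ 2 ≤ imNorm (u t₀) ^ 2 + ‖p₁‖ ^ 2 →
        ∃! T, t₀ ≤ T ∧ totalEnergy C₀ τ δ q u T = 0) := by
  obtain ⟨pd, v, hv⟩ := hex
  obtain ⟨ud, hud'⟩ := exists_isRobinSolution Ω (extendLp h₀ hsub (J pd))
    (hdata.mem₁'.mono_exponent le_top) (hdata.mem₂'.mono_exponent le_top)
  have hud : IsRobinSolution Ω (extend Ω₀ (J pd)) g₁' g₂' ud :=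
    hud'.congr (coeFn_extendLp h₀ hsub _)
  obtain ⟨a, hflow⟩ := h.exists_isDampedFlow h₀ hsub hud
  -- Here `τ > 1` provides the strict gap between the exact residual and the level.
  have hb : ‖imPart ud‖ < C₀ * τ * δ := by
    have e := hC₀.bound Ω₀ h₀ hsub δ g₁ g₂ g₁' g₂' hdata (J pd) v hv ud hud
    rw [imNorm_eq] at e
    have e2 : 0 < C₀ * δ := mul_pos hC₀.pos hdata.pos
    nlinarith
  have hb2 : ‖imPart ud‖ ^ 2 < C₀ ^ 2 * τ ^ 2 * δ ^ 2 := by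
    have := pow_lt_pow_left₀ hb (norm_nonneg _) two_ne_zero
    rwa [mul_pow, mul_pow] at this
  simp only [morozov, totalEnergy, imNorm_eq]
  refine ⟨hflow.exists_residual_eq hη hb, fun he => ?_⟩
  refine hflow.existsUnique_energy_eq hη hb2 ?_
  rwa [h.init_vel]

end Flow

end

end InverseSource

/-! ### The theorem for both source spaces. -/

theorem lemma4p3 {d : ℕ} (hd : d = 2 ∨ d = 3) {Ω : Set (E d)} (hΩ : IsSmoothBoundedDomain Ω) :
    (∃ C₀ : ℝ, IsDataErrorConstant Ω C₀) ∧
    ∀ C₀ : ℝ, IsDataErrorConstant Ω C₀ →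
    ∀ Ω₀ : Set (E d), IsOpen Ω₀ → Ω₀ ⊆ Ω →
    ∀ (δ : ℝ) (g₁ g₂ g₁' g₂' : E d → ℝ), IsNoisyData Ω δ g₁ g₂ g₁' g₂' →
    ∀ τ : ℝ, 1 < τ → ∀ (t₀ : ℝ) (η : ℝ → ℝ), IsDamping t₀ η →
      -- the space of sources `P = L²(Ω₀)`
      ((∃ (pd : L2 ℝ Ω₀) (v : H1 ℝ Ω), IsExactSolution Ω Ω₀ g₁ g₂ pd v) →
        ∀ (p₀ p₁ : L2 ℝ Ω₀) (p q : ℝ → L2 ℝ Ω₀) (u w : ℝ → H1 ℂ Ω),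
        IsDynamicSolution Ω Ω₀ (ContinuousLinearMap.id ℝ (L2 ℝ Ω₀)) t₀ η g₁' g₂' p₀ p₁ p q u w →
        (C₀ * τ * δ ≤ imNorm (u t₀) →
          ∃ T, t₀ ≤ T ∧ morozov C₀ τ δ u T = 0) ∧
        (C₀ ^ 2 * τ ^ 2 * δ ^ 2 ≤ imNorm (u t₀) ^ 2 + ‖p₁‖ ^ 2 →
          ∃! T, t₀ ≤ T ∧ totalEnergy C₀ τ δ q u T = 0)) ∧
      -- the space of sources `P = H¹(Ω₀)`
      ((∃ (pd : H1 ℝ Ω₀) (v : H1 ℝ Ω), IsExactSolution Ω Ω₀ g₁ g₂ (H1.incl Ω₀ pd) v) →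
        ∀ (p₀ p₁ : H1 ℝ Ω₀) (p q : ℝ → H1 ℝ Ω₀) (u w : ℝ → H1 ℂ Ω),
        IsDynamicSolution Ω Ω₀ (H1.incl Ω₀) t₀ η g₁' g₂' p₀ p₁ p q u w →
        (C₀ * τ * δ ≤ imNorm (u t₀) →
          ∃ T, t₀ ≤ T ∧ morozov C₀ τ δ u T = 0) ∧
        (C₀ ^ 2 * τ ^ 2 * δ ^ 2 ≤ imNorm (u t₀) ^ 2 + ‖p₁‖ ^ 2 →
          ∃! T, t₀ ≤ T ∧ totalEnergy C₀ τ δ q u T = 0)) := by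
  have : IsFiniteMeasure (surface Ω) :=
    hΩ.isFiniteMeasure_surface (by omega)
  refine ⟨exists_isDataErrorConstant, ?_⟩
  intro C₀ hC₀ Ω₀ h₀ hsub δ g₁ g₂ g₁' g₂' hdata τ hτ t₀ η hη
  exact ⟨fun hex p₀ p₁ p q u w h => h.roots hC₀ h₀ hsub hdata hτ hη hex,
    fun hex p₀ p₁ p q u w h => h.roots hC₀ h₀ hsub hdata hτ hη hex⟩
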